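/- **Theorem (Energy inequality).** Let $d\in\{2,3\}$, let $\Omega\subset\mathbb R^d$ be open and bounded, let $\kappa,\sigma,\tau>0$, $L\ge 0$ and $S\ge 2L$. For $d=2$ the curl of a vector field is the scalar $\partial_1A_2-\partial_2A_1$, and the applied field is scalar; for $d=3$ both are vectors in $\mathbb R^3$. Let $f,F:\Omega\times[0,\infty)\to\mathbb R$ satisfy the following: for each $s\in[0,1]$, $f(\cdot,s)$ is measurable and $F(\cdot,s)\in L^1(\Omega)$; for each $x\in\Omega$, $F(x,\cdot)$ is an antiderivative of $f(x,\cdot)$ on $[0,1]$ (one-sided derivatives at the endpoints), and $f(x,\cdot)$ is Lipschitz on $[0,1]$ with constant $L$ (that is, $|\partial_sf|\le L$ there if $f$ is differentiable in $s$); and $x\mapsto f(x,1)$ is bounded with $f(x,1)\ge0$ (for example $f(\cdot,1)=0$). Let $N\in\mathbb N$ and let $H^n\in L^2(\Omega)$, $\psi^n\in H^1(\Omega;\mathbb C)$, $A^n\in H(\mathrm{curl},\Omega)$ ($0\le n\le N$) be such that $|\psi^0|\le1$ a.e. and, for $1\le n\le N$, $(\psi^n,A^n)$ is a weak solution of the IMEX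 scheme with $\phi=0$ $$\frac{\psi^n-\psi^{n-1}}\tau+\Big(\frac i\kappa\nabla+A^{n-1}\Big)^2\psi^n+f(x,|\psi^{n-1}|^2)\psi^n+S(\psi^n-\psi^{n-1})=0,$$ $$\sigma\frac{A^n-A^{n-1}}\tau+\mathrm{curl}\,\mathrm{curl}\,A^n+\frac1\kappa\mathrm{Im}(\psi^n\nabla\overline{\psi^n})+A^n|\psi^n|^2=\mathrm{curl}\,H^n$$ in $\Omega$ with $(\frac i\kappa\nabla+A^{n-1})\psi^n\cdot\nu=0$ and $\nu\times\mathrm{curl}\,A^n=\nu\times H^n$ on $\partial\Omega$ ($\nu$ the unit outer normal). Here weak solution means that $(\frac i\kappa\nabla+A^{n-1})\psi^n\in L^2(\Omega)$, that $$\int_\Omega\Big(\frac{\psi^n-\psi^{n-1}}\tau+f(x,|\psi^{n-1}|^2)\psi^n+S(\psi^n-\psi^{n-1})\Big)\overline\chi+\Big(\frac i\kappa\nabla+A^{n-1}\Big)\psi^n\cdot\overline{\Big(\frac i\kappa\nabla+A^{n-1}\Big)\chi}\,dx=0$$ for all $\chi\in H^1(\Omega;\mathbb C)\cap L^\infty(\Omega)$,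 and that $$\int_\Omega\frac\sigma\tau(A^n-A^{n-1})\cdot B+(\mathrm{curl}\,A^n-H^n)\cdot\mathrm{curl}\,B+\Big(\frac1\kappa\mathrm{Im}(\psi^n\nabla\overline{\psi^n})+A^n|\psi^n|^2\Big)\cdot B\,dx=0$$ for all $B\in H(\mathrm{curl},\Omega)$. Then for $0\le n\le N$ the energy density is integrable, so the discrete Ginzburg–Landau energy $$E^n=\frac12\int_\Omega\Big|\Big(\frac i\kappa\nabla+A^n\Big)\psi^n\Big|^2+F(x,|\psi^n|^2)+|\mathrm{curl}\,A^n-H^n|^2\,dx$$ is well defined, and for $1\le n\le N$ $$E^n-E^{n-1}\le\int_\Omega(H^n-\mathrm{curl}\,A^n)\cdot(H^n-H^{n-1})\,dx .$$ In particular $E^n\le E^{n-1}$ whenever $H^n=H^{n-1}$ a.e.; the energy is nonincreasing for an applied field that is constant in time. -/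

import Mathlib

open MeasureTheory Set
open scoped ContDiff ComplexConjugate

noncomputable section

namespace TDGL

/-- The two space dimensions of the model. -/
inductive SpaceDim
  | two
  | three

/-- The dimension `d` of the space `ℝ^d`. -/
def SpaceDim.dim : SpaceDim → ℕ
  | .two => 2
  | .three => 3

/-- The number of components of the curl of a vector field: a scalar in the plane, a vector with
three components in space. -/
def SpaceDim.curlDim : SpaceDim → ℕ
  | .two => 1
  | .three => 3

/-- The coefficients `ε k i j` in `(curl A)_k = ∑ i j, ε k i j * ∂_i A_j`. In the plane this gives
`∂_0 A_1 - ∂_1 A_0`; in space `ε` is the Levi-Civita symbol (the addition is modulo 3). -/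
def curlSymbol : (D : SpaceDim) → Fin D.curlDim → Fin D.dim → Fin D.dim → ℝ
  | .two => fun _ i j => !![(0 : ℝ), 1; -1, 0] i j
  | .three => fun (k i j : Fin 3) =>
      if i = k + 1 ∧ j = k + 2 then 1 else if i = k + 2 ∧ j = k + 1 then -1 else 0

/-- The Euclidean space `ℝ^d`: the space of points, and of values of the vector potential. -/
abbrev Space (D : SpaceDim) : Type := EuclideanSpace ℝ (Fin D.dim)

/-- The values of `curl A` and of the applied field `H`. -/
abbrev CurlSpace (D : SpaceDim) : Type := EuclideanSpace ℝ (Fin D.curlDim)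

/-- The values of the gradient of a complex function. -/
abbrev GradSpace (D : SpaceDim) : Type := EuclideanSpace ℂ (Fin D.dim)

variable {D : SpaceDim}

/-- `φ ∈ C_c^∞(Ω)`. -/
def IsTestFunction (Ω : Set (Space D)) (φ : Space D → ℝ) : Prop :=
  ContDiff ℝ ∞ φ ∧ HasCompactSupport φ ∧ tsupport φ ⊆ Ω

/-- The partial derivative `∂_i φ`. -/
def partialDeriv (i : Fin D.dim) (φ : Space D → ℝ) (x : Space D) : ℝ :=
  fderiv ℝ φ x (EuclideanSpace.single i 1)

/-- `g` is the weak gradient of `u` on `Ω`. -/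
def IsWeakGrad (Ω : Set (Space D)) (u : Space D → ℂ) (g : Space D → GradSpace D) : Prop :=
  ∀ φ : Space D → ℝ, IsTestFunction Ω φ → ∀ i : Fin D.dim,
    ∫ x in Ω, (φ x : ℂ) * g x i = -∫ x in Ω, (partialDeriv i φ x : ℂ) * u x

/-- `c` is the weak curl of `a` on `Ω`. -/
def IsWeakCurl (Ω : Set (Space D)) (a : Space D → Space D) (c : Space D → CurlSpace D) : Prop :=
  ∀ φ : Space D → ℝ, IsTestFunction Ω φ → ∀ k : Fin D.curlDim,
    ∫ x in Ω, φ x * c x k =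
      -∫ x in Ω, ∑ i, ∑ j, curlSymbol D k i j * (partialDeriv i φ x * a x j)

/-- An element of the complex Sobolev space `H¹(Ω)`, together with its weak gradient. -/
structure H1 (Ω : Set (Space D)) where
  /-- the function -/
  val : Space D → ℂ
  /-- its weak gradient -/
  grad : Space D → GradSpace D
  val_memLp : MemLp val 2 (volume.restrict Ω)
  grad_memLp : MemLp grad 2 (volume.restrict Ω)
  isWeakGrad : IsWeakGrad Ω val grad

/-- An element of the real space `H(curl, Ω)`, together with its weak curl. -/
structure HCurl (Ω : Set (Space D)) where
  /-- the vector field -/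
  val : Space D → Space D
  /-- its weak curl -/
  curl : Space D → CurlSpace D
  val_memLp : MemLp val 2 (volume.restrict Ω)
  curl_memLp : MemLp curl 2 (volume.restrict Ω)
  isWeakCurl : IsWeakCurl Ω val curl

variable {Ω : Set (Space D)}

/-- The covariant gradient `(i/κ ∇ + A) ψ`. -/
def covGrad (κ : ℝ) (A : HCurl Ω) (ψ : H1 Ω) (x : Space D) : GradSpace D :=
  (Complex.I / (κ : ℂ)) • ψ.grad x + WithLp.toLp 2 fun j => (A.val x j : ℂ) * ψ.val x

/-- The vector field `(1/κ) Im(ψ ∇ψ*) + A |ψ|²`. -/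
def current (κ : ℝ) (A : HCurl Ω) (ψ : H1 Ω) (x : Space D) : Space D :=
  WithLp.toLp 2 fun j =>
    (1 / κ) * (ψ.val x * conj (ψ.grad x j)).im + A.val x j * ‖ψ.val x‖ ^ 2

/-- One step of the scheme with `φ = 0`, from `(ψ₀, A₀)` to `(ψ, A)` with applied field `h`, in
weak form:

* `(ψ - ψ₀)/τ + (i/κ ∇ + A₀)² ψ + f(x, |ψ₀|²) ψ + S (ψ - ψ₀) = 0`,
* `σ (A - A₀)/τ + curl curl A + (1/κ) Im(ψ ∇ψ*) + A |ψ|² = curl h`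

in `Ω`, with `((i/κ ∇ + A₀) ψ) · n = 0` and `n × curl A = n × h` on the boundary, which
are the natural boundary conditions of the weak form. -/
structure IsImexStep (κ σ τ S : ℝ) (f : Space D → ℝ → ℝ) (ψ₀ : H1 Ω) (A₀ : HCurl Ω)
    (ψ : H1 Ω) (A : HCurl Ω) (h : Space D → CurlSpace D) : Prop where
  covGrad_memLp : MemLp (covGrad κ A₀ ψ) 2 (volume.restrict Ω)
  psi_eq : ∀ χ : H1 Ω, (∃ M : ℝ, ∀ᵐ x ∂(volume.restrict Ω), ‖χ.val x‖ ≤ M) →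
    ∫ x in Ω, (((ψ.val x - ψ₀.val x) / (τ : ℂ) + (f x (‖ψ₀.val x‖ ^ 2) : ℂ) * ψ.val x
          + (S : ℂ) * (ψ.val x - ψ₀.val x)) * conj (χ.val x)
        + ∑ j, covGrad κ A₀ ψ x j * conj (covGrad κ A₀ χ x j)) = 0
  A_eq : ∀ B : HCurl Ω,
    ∫ x in Ω, ((σ / τ) * inner ℝ (A.val x - A₀.val x) (B.val x)
        + inner ℝ (A.curl x - h x) (B.curl x)
        + inner ℝ (current κ A ψ x) (B.val x)) = 0

/-- The integrand `|(i/κ ∇ + A) ψ|² + F(x, |ψ|²) + |curl A - h|²`. -/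
def energyDensity (κ : ℝ) (F : Space D → ℝ → ℝ) (ψ : H1 Ω) (A : HCurl Ω)
    (h : Space D → CurlSpace D) (x : Space D) : ℝ :=
  ‖covGrad κ A ψ x‖ ^ 2 + F x (‖ψ.val x‖ ^ 2) + ‖A.curl x - h x‖ ^ 2

/-- The discrete Ginzburg-Landau energy. -/
def energy (κ : ℝ) (F : Space D → ℝ → ℝ) (ψ : H1 Ω) (A : HCurl Ω)
    (h : Space D → CurlSpace D) : ℝ :=
  (1 / 2) * ∫ x in Ω, energyDensity κ F ψ A h x

end TDGL

end

/-!
The energy inequality rests on a maximum principle: all iterates satisfy `|ψⁿ| ≤ 1` almost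
everywhere. Granted this, the increments `ψⁿ⁺¹ - ψⁿ` and `Aⁿ⁺¹ - Aⁿ` are admissible test functions.
The real part of the first equation, tested with the former, and the second equation, tested with
the latter, add up to an identity whose integrand, after adding
`(Hⁿ⁺¹ - curl Aⁿ⁺¹) · (Hⁿ⁺¹ - Hⁿ)`, dominates the increment of half the energy density pointwise:

* the covariant gradient with the old potential is treated by
  `Re (p (p - q)*) ≥ (|p|² - |q|²) / 2`, and the change of potential by the convexity of
  `A ↦ |(i/κ ∇ + A) ψ|²`, whose derivative is twice the current;
* the potential `F(x, |ψ|²)` is expanded by Taylor's inequality at the old value; the remainder is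
  at most `2 L |ψⁿ⁺¹ - ψⁿ|²` and `f(x, |ψⁿ|²) ≥ -L`, so that `S ≥ 2 L` absorbs both
  (`potential_le_re_reaction_mul_conj_sub`);
* polarization of `|curl A - H|²` produces the term with the increment of the applied field.

The maximum principle (`IsImexStep.norm_val_le_one`) is proved by testing the first equation with
`G(ψⁿ⁺¹)`, where `G(z) = h(|z|²) z` is bounded and `C¹`, vanishes on the unit disc, and has
nondecreasing radial profile. The gradient term is then nonnegative pointwise
(`re_covDeriv_mul_conj_radialTrunc_nonneg`), and the remaining terms are positive where
`|ψⁿ⁺¹| > 1` (`re_reaction_mul_conj_pos`), so this set is null. That `G(ψⁿ⁺¹)` belongs to `H¹(Ω)` is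
the chain rule for weak derivatives (`weakDeriv_comp`), obtained by mollification: mollified
functions converge almost everywhere, mollified derivatives in `L¹`, and the test function restricts
everything to a compact subset of `Ω`.

The compositions `f(x, |ψ|²)` and `F(x, |ψ|²)` are measurable since `f` and `F` are measurable in
`x` and continuous in `s` (`aemeasurable_comp_of_continuousOn`).
-/

namespace TDGL

/-! ### Mollification in `L¹` -/

section Mollification

open Filter ContinuousLinearMap
open scoped Topology Convolution

variable {E : Type*} [NormedAddCommGroup E] [NormedSpace ℝ E] [FiniteDimensional ℝ E]
  [MeasurableSpace E] [BorelSpace E] {μ : Measure E} [μ.IsAddHaarMeasure]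

theorem integrable_normed_convolution (η : ContDiffBump (0 : E)) {w : E → ℂ}
    (hw : Integrable w μ) : Integrable (η.normed μ ⋆[lsmul ℝ ℝ, μ] w) μ :=
  Integrable.integrable_convolution _ η.integrable_normed hw

/-- Mollification does not increase the `L¹` norm. -/
theorem integral_norm_normed_convolution_le (η : ContDiffBump (0 : E)) {w : E → ℂ}
    (hw : Integrable w μ) :
    ∫ x, ‖(η.normed μ ⋆[lsmul ℝ ℝ, μ] w) x‖ ∂μ ≤ ∫ x, ‖w x‖ ∂μ := by
  calc ∫ x, ‖(η.normed μ ⋆[lsmul ℝ ℝ, μ] w) x‖ ∂μ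
      ≤ ∫ x, (η.normed μ ⋆[lsmul ℝ ℝ, μ] fun y => ‖w y‖) x ∂μ := by
        refine integral_mono (integrable_normed_convolution η hw).norm
          (Integrable.integrable_convolution _ η.integrable_normed hw.norm) fun x => ?_
        simp only [convolution_def, lsmul_apply]
        refine (norm_integral_le_integral_norm _).trans_eq (integral_congr_ae ?_)
        filter_upwards with t
        rw [norm_smul, Real.norm_of_nonneg (η.nonneg_normed _), smul_eq_mul]
    _ = ∫ x, ‖w x‖ ∂μ := by
        rw [integral_convolution (lsmul ℝ ℝ) η.integrable_normed hw.norm, η.integral_normed]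
        simp

/-- If `‖wₙ‖₁ ≤ ‖w‖₁` and `wₙ → w` almost everywhere, then `wₙ → w` in `L¹`: the functions
`‖wₙ‖ + ‖w‖ - ‖wₙ - w‖` are bounded by `2 ‖w‖` in absolute value and converge to `2 ‖w‖`. -/
theorem tendsto_integral_norm_sub_of_ae_of_le {α : Type*} [MeasurableSpace α] {ν : Measure α}
    {w : α → ℂ} {wn : ℕ → α → ℂ} (hw : Integrable w ν) (hwn : ∀ n, Integrable (wn n) ν)
    (hle : ∀ n, ∫ x, ‖wn n x‖ ∂ν ≤ ∫ x, ‖w x‖ ∂ν)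
    (hae : ∀ᵐ x ∂ν, Tendsto (fun n => wn n x) atTop (𝓝 (w x))) :
    Tendsto (fun n => ∫ x, ‖wn n x - w x‖ ∂ν) atTop (𝓝 0) := by
  have hlim : Tendsto (fun n => ∫ x, (‖wn n x‖ + ‖w x‖ - ‖wn n x - w x‖) ∂ν) atTop
      (𝓝 (∫ x, 2 * ‖w x‖ ∂ν)) := by
    refine tendsto_integral_of_dominated_convergence (fun x => 2 * ‖w x‖) ?_ (hw.norm.const_mul 2)
      ?_ ?_
    · exact fun n => (((hwn n).norm.add hw.norm).sub ((hwn n).sub hw).norm).aestronglyMeasurable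
    · intro n
      filter_upwards with x
      have h1 := norm_sub_norm_le (wn n x) (w x)
      have h2 := norm_sub_le (wn n x) (w x)
      have h3 : ‖w x‖ ≤ ‖wn n x‖ + ‖wn n x - w x‖ := by
        simpa using norm_sub_le (wn n x) (wn n x - w x)
      rw [Real.norm_eq_abs, abs_le]
      constructor <;> linarith [norm_nonneg (w x)]
    · filter_upwards [hae] with x hx
      have h : Tendsto (fun n => ‖wn n x‖ + ‖w x‖ - ‖wn n x - w x‖) atTop
          (𝓝 (‖w x‖ + ‖w x‖ - ‖w x - w x‖)) :=
        (hx.norm.add tendsto_const_nhds).sub (hx.sub tendsto_const_nhds).norm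
      convert h using 2
      simp; ring
  have hlim' := (tendsto_const_nhds (x := ∫ x, 2 * ‖w x‖ ∂ν)).sub hlim
  rw [sub_self] at hlim'
  refine squeeze_zero (fun n => integral_nonneg fun x => norm_nonneg _) (fun n => ?_) hlim'
  have h1 : ∫ x, (‖wn n x‖ + ‖w x‖ - ‖wn n x - w x‖) ∂ν =
      ∫ x, ‖wn n x‖ ∂ν + ∫ x, ‖w x‖ ∂ν - ∫ x, ‖wn n x - w x‖ ∂ν := by
    rw [← integral_add (hwn n).norm hw.norm]
    exact integral_sub ((hwn n).norm.add hw.norm) ((hwn n).sub hw).norm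
  rw [h1, integral_const_mul]
  linarith [hle n]

/-- The derivative of a mollification is the mollification of the weak derivative, at points whose
distance to the complement of `Ω` exceeds the radius of the mollifier. -/
theorem fderiv_normed_convolution_indicator {Ω : Set E} (hΩ : IsOpen Ω) {e : E} {v w : E → ℂ}
    (hv : IntegrableOn v Ω μ)
    (hvw : ∀ φ : E → ℝ, ContDiff ℝ ∞ φ → HasCompactSupport φ → tsupport φ ⊆ Ω →
      ∫ x in Ω, (φ x : ℂ) * w x ∂μ = -∫ x in Ω, (fderiv ℝ φ x e : ℂ) * v x ∂μ)
    (η : ContDiffBump (0 : E)) {x : E} (hx : Metric.closedBall x η.rOut ⊆ Ω) :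
    fderiv ℝ (η.normed μ ⋆[lsmul ℝ ℝ, μ] Ω.indicator v) x e =
      (η.normed μ ⋆[lsmul ℝ ℝ, μ] Ω.indicator w) x := by
  have hV : Integrable (Ω.indicator v) μ := hv.integrable_indicator hΩ.measurableSet
  have hη : ContDiff ℝ ∞ (η.normed μ) := η.contDiff_normed
  have hd := η.hasCompactSupport_normed (μ := μ) |>.hasFDerivAt_convolution_left (lsmul ℝ ℝ)
    (hη.of_le (by norm_num)) hV.locallyIntegrable x
  rw [hd.fderiv]
  set φ : E → ℝ := fun y => η.normed μ (x - y) with hφ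
  have hφ_smooth : ContDiff ℝ ∞ φ := hη.comp (contDiff_const.sub contDiff_id)
  have hsupp : tsupport φ ⊆ Metric.closedBall x η.rOut := by
    refine closure_minimal (fun y hy => ?_) Metric.isClosed_closedBall
    have : x - y ∈ Function.support (η.normed μ) := hy
    rw [η.support_normed_eq] at this
    simpa [dist_eq_norm, norm_sub_rev] using (Metric.ball_subset_closedBall this)
  have hφ_cpt : HasCompactSupport φ :=
    (isCompact_closedBall x η.rOut).of_isClosed_subset (isClosed_tsupport _) hsupp
  have key := hvw φ hφ_smooth hφ_cpt (hsupp.trans hx)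
  have hφ' : ∀ y, fderiv ℝ φ y e = -fderiv ℝ (η.normed μ) (x - y) e := by
    intro y
    have h1 : HasFDerivAt φ
        ((fderiv ℝ (η.normed μ) (x - y)).comp (-ContinuousLinearMap.id ℝ E)) y :=
      ((hη.differentiable (by norm_num)) (x - y)).hasFDerivAt.comp y
        ((hasFDerivAt_id y).const_sub x)
    rw [h1.fderiv]; simp
  have hint : ConvolutionExistsAt (fderiv ℝ (η.normed μ)) (Ω.indicator v) x
      ((lsmul ℝ ℝ : ℝ →L[ℝ] ℂ →L[ℝ] ℂ).precompL E) μ :=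
    (η.hasCompactSupport_normed (μ := μ) |>.fderiv ℝ).convolutionExists_left _
      (hη.continuous_fderiv (by norm_num)) hV.locallyIntegrable x
  rw [convolution_eq_swap, convolution_eq_swap,
    ContinuousLinearMap.integral_apply hint.integrable_swap]
  have e1 : ∀ t, ((lsmul ℝ ℝ : ℝ →L[ℝ] ℂ →L[ℝ] ℂ).precompL E (fderiv ℝ (η.normed μ) (x - t))
      (Ω.indicator v t)) e = Ω.indicator (fun t => -((fderiv ℝ φ t e : ℂ) * v t)) t := by
    intro t
    by_cases ht : t ∈ Ω
    · simp [precompL_apply, ht, hφ']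
    · simp [ht]
  have e2 : ∀ t, (lsmul ℝ ℝ : ℝ →L[ℝ] ℂ →L[ℝ] ℂ) (η.normed μ (x - t)) (Ω.indicator w t) =
      Ω.indicator (fun t => (φ t : ℂ) * w t) t := by
    intro t
    by_cases ht : t ∈ Ω <;> simp [ht, hφ]
  simp_rw [e1, e2]
  rw [integral_indicator hΩ.measurableSet, integral_indicator hΩ.measurableSet, key, integral_neg]

end Mollification

/-! ### The chain rule for weak derivatives -/

section ChainRule

open Filter ContinuousLinearMap
open scoped Topology Convolution

variable {E : Type*} [NormedAddCommGroup E] [NormedSpace ℝ E] [FiniteDimensional ℝ E]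
  [MeasurableSpace E] [BorelSpace E] {μ : Measure E} [μ.IsAddHaarMeasure]

theorem aestronglyMeasurable_clm_apply {α : Type*} [MeasurableSpace α] {ν : Measure α}
    {T : α → ℂ →L[ℝ] ℂ} {u : α → ℂ} (hT : AEStronglyMeasurable T ν)
    (hu : AEStronglyMeasurable u ν) : AEStronglyMeasurable (fun x => T x (u x)) ν :=
  isBoundedBilinearMap_apply.continuous.comp_aestronglyMeasurable₂ hT hu

/-- Integration by parts for the composition of a bounded `C¹` map with a smooth function. -/
theorem integral_mul_fderiv_comp {V : E → ℂ} (hV : ContDiff ℝ 1 V) {G : ℂ → ℂ}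
    (hG : ContDiff ℝ 1 G) {φ : E → ℝ} (hφ : ContDiff ℝ ∞ φ) (hφc : HasCompactSupport φ) (e : E) :
    ∫ x, (φ x : ℂ) * fderiv ℝ G (V x) (fderiv ℝ V x e) ∂μ =
      -∫ x, (fderiv ℝ φ x e : ℂ) * G (V x) ∂μ := by
  have hGV : ContDiff ℝ 1 (fun x => G (V x)) := hG.comp hV
  have hd : ∀ x, fderiv ℝ (fun x => G (V x)) x e = fderiv ℝ G (V x) (fderiv ℝ V x e) := by
    intro x
    have := ((hG.differentiable (by norm_num)) (V x)).hasFDerivAt.comp x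
      ((hV.differentiable (by norm_num)) x).hasFDerivAt
    rw [show (fun x => G (V x)) = G ∘ V from rfl, this.fderiv]; rfl
  have hφd : Continuous fun x => fderiv ℝ φ x e :=
    (hφ.continuous_fderiv (by norm_num)).clm_apply continuous_const
  have hφdc : HasCompactSupport fun x => fderiv ℝ φ x e := hφc.fderiv_apply ℝ e
  have hGVd : Continuous fun x => fderiv ℝ (fun x => G (V x)) x e :=
    (hGV.continuous_fderiv (by norm_num)).clm_apply continuous_const
  have h := integral_smul_fderiv_eq_neg_fderiv_smul_of_integrable (μ := μ) (𝕜 := ℝ) (f := φ)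
    (g := fun x => G (V x)) (v := e)
    ((hφd.smul hGV.continuous).integrable_of_hasCompactSupport hφdc.smul_right)
    ((hφ.continuous.smul hGVd).integrable_of_hasCompactSupport hφc.smul_right)
    ((hφ.continuous.smul hGV.continuous).integrable_of_hasCompactSupport hφc.smul_right)
    (fun x _ => (hφ.differentiable (by norm_num)) x)
    (fun x _ => (hGV.differentiable (by norm_num)) x)
  simpa only [hd, Complex.real_smul] using h

/-- The chain rule for weak directional derivatives: if `w` is the weak derivative of `v` in the
direction `e`, then `DG(v) w` is that of `G ∘ v`, for bounded `C¹` maps `G` with bounded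
derivative. -/
theorem weakDeriv_comp {Ω : Set E} (hΩ : IsOpen Ω) {e : E} {v w : E → ℂ}
    (hv : IntegrableOn v Ω μ) (hw : IntegrableOn w Ω μ)
    (hvw : ∀ φ : E → ℝ, ContDiff ℝ ∞ φ → HasCompactSupport φ → tsupport φ ⊆ Ω →
      ∫ x in Ω, (φ x : ℂ) * w x ∂μ = -∫ x in Ω, (fderiv ℝ φ x e : ℂ) * v x ∂μ)
    {G : ℂ → ℂ} (hG : ContDiff ℝ 1 G) {C C' : ℝ} (hGb : ∀ z, ‖G z‖ ≤ C)
    (hGd : ∀ z, ‖fderiv ℝ G z‖ ≤ C')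
    {φ : E → ℝ} (hφ : ContDiff ℝ ∞ φ) (hφc : HasCompactSupport φ) (hφΩ : tsupport φ ⊆ Ω) :
    ∫ x in Ω, (φ x : ℂ) * fderiv ℝ G (v x) (w x) ∂μ =
      -∫ x in Ω, (fderiv ℝ φ x e : ℂ) * G (v x) ∂μ := by
  set V := Ω.indicator v with hVdef
  set W := Ω.indicator w with hWdef
  have hV : Integrable V μ := hv.integrable_indicator hΩ.measurableSet
  have hW : Integrable W μ := hw.integrable_indicator hΩ.measurableSet
  have hC' : 0 ≤ C' := (norm_nonneg _).trans (hGd 0)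
  -- Almost everywhere convergence of the mollified functions needs radii of bounded ratio.
  let η : ℕ → ContDiffBump (0 : E) := fun n =>
    ⟨1 / (2 * ((n : ℝ) + 1)), 1 / ((n : ℝ) + 1), by positivity,
      one_div_lt_one_div_of_lt (by positivity) (by linarith [(n.cast_nonneg : (0 : ℝ) ≤ n)])⟩
  have hη0 : Tendsto (fun n => (η n).rOut) atTop (𝓝 0) := tendsto_one_div_add_atTop_nhds_zero_nat
  have hηK : ∀ᶠ n in atTop, (η n).rOut ≤ 2 * (η n).rIn := by
    filter_upwards with n
    change 1 / ((n : ℝ) + 1) ≤ 2 * (1 / (2 * ((n : ℝ) + 1)))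
    apply le_of_eq; field_simp
  set Vn : ℕ → E → ℂ := fun n => (η n).normed μ ⋆[lsmul ℝ ℝ, μ] V with hVn
  set Wn : ℕ → E → ℂ := fun n => (η n).normed μ ⋆[lsmul ℝ ℝ, μ] W with hWn
  have hVn_smooth : ∀ n, ContDiff ℝ 1 (Vn n) := fun n =>
    (η n).hasCompactSupport_normed.contDiff_convolution_left (n := 1) _ (η n).contDiff_normed
      hV.locallyIntegrable
  have hVn_lim : ∀ᵐ x ∂μ, Tendsto (fun n => Vn n x) atTop (𝓝 (V x)) :=
    ContDiffBump.ae_convolution_tendsto_right_of_locallyIntegrable hη0 hηK hV.locallyIntegrable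
  have hWn_lim : ∀ᵐ x ∂μ, Tendsto (fun n => Wn n x) atTop (𝓝 (W x)) :=
    ContDiffBump.ae_convolution_tendsto_right_of_locallyIntegrable hη0 hηK hW.locallyIntegrable
  have hWn_int : ∀ n, Integrable (Wn n) μ := fun n => integrable_normed_convolution (η n) hW
  have hWn_L1 : Tendsto (fun n => ∫ x, ‖Wn n x - W x‖ ∂μ) atTop (𝓝 0) :=
    tendsto_integral_norm_sub_of_ae_of_le hW hWn_int
      (fun n => integral_norm_normed_convolution_le (η n) hW) hWn_lim
  have hG' : Continuous (fderiv ℝ G) := hG.continuous_fderiv (by norm_num)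
  obtain ⟨Cφ, hCφ⟩ := hφc.exists_bound_of_continuous hφ.continuous
  have hCφ0 : 0 ≤ Cφ := (norm_nonneg _).trans (hCφ 0)
  have hφd : Continuous fun x => fderiv ℝ φ x e :=
    (hφ.continuous_fderiv (by norm_num)).clm_apply continuous_const
  have hφd_int : Integrable (fun x => fderiv ℝ φ x e) μ :=
    hφd.integrable_of_hasCompactSupport (hφc.fderiv_apply ℝ e)
  -- The identity for the mollified functions, with the classical chain rule.
  obtain ⟨δ, hδ, hδΩ⟩ := hφc.isCompact.exists_cthickening_subset_open hΩ hφΩ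
  have hid : ∀ᶠ n in atTop, ∫ x, (φ x : ℂ) * fderiv ℝ G (Vn n x) (Wn n x) ∂μ =
      -∫ x, (fderiv ℝ φ x e : ℂ) * G (Vn n x) ∂μ := by
    filter_upwards [hη0.eventually (gt_mem_nhds hδ)] with n hn
    rw [← integral_mul_fderiv_comp (hVn_smooth n) hG hφ hφc e]
    refine integral_congr_ae (Eventually.of_forall fun x => ?_)
    by_cases hx : x ∈ tsupport φ
    · have hball : Metric.closedBall x (η n).rOut ⊆ Ω :=
        (Metric.closedBall_subset_closedBall hn.le).trans
          ((Metric.closedBall_subset_cthickening hx δ).trans hδΩ)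
      have := fderiv_normed_convolution_indicator hΩ hv hvw (η n) hball
      simp only [hVn, hWn, hVdef, hWdef]
      rw [this]
    · simp [image_eq_zero_of_notMem_tsupport hx]
  -- Convergence of the right-hand side.
  have hR : Tendsto (fun n => -∫ x, (fderiv ℝ φ x e : ℂ) * G (Vn n x) ∂μ) atTop
      (𝓝 (-∫ x, (fderiv ℝ φ x e : ℂ) * G (V x) ∂μ)) := by
    refine (tendsto_integral_of_dominated_convergence (fun x => ‖fderiv ℝ φ x e‖ * C) ?_
      (hφd_int.norm.mul_const C) ?_ ?_).neg
    · intro n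
      exact ((Complex.continuous_ofReal.comp hφd).mul
        (hG.continuous.comp (hVn_smooth n).continuous)).aestronglyMeasurable
    · intro n
      filter_upwards with x
      rw [norm_mul, Complex.norm_real]
      gcongr
      exact hGb _
    · filter_upwards [hVn_lim] with x hx
      exact tendsto_const_nhds.mul ((hG.continuous.tendsto _).comp hx)
  -- Convergence of the left-hand side: replace `Wn` by `W`, then let `Vn` converge to `V`.
  have hbound : ∀ (x : E) (z ζ : ℂ), ‖(φ x : ℂ) * fderiv ℝ G z ζ‖ ≤ Cφ * C' * ‖ζ‖ := by
    intro x z ζ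
    rw [norm_mul, Complex.norm_real, mul_assoc]
    gcongr
    · exact hCφ x
    · exact (fderiv ℝ G z).le_of_opNorm_le (hGd z) ζ
  have hmeas : ∀ {U u : E → ℂ}, AEStronglyMeasurable U μ → AEStronglyMeasurable u μ →
      AEStronglyMeasurable (fun x => (φ x : ℂ) * fderiv ℝ G (U x) (u x)) μ := fun hU hu =>
    (Complex.continuous_ofReal.comp hφ.continuous).aestronglyMeasurable.mul
      (aestronglyMeasurable_clm_apply (hG'.comp_aestronglyMeasurable hU) hu)
  have hint : ∀ {U u : E → ℂ}, AEStronglyMeasurable U μ → Integrable u μ →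
      Integrable (fun x => (φ x : ℂ) * fderiv ℝ G (U x) (u x)) μ := fun hU hu =>
    (hu.norm.const_mul (Cφ * C')).mono' (hmeas hU hu.1)
      (Eventually.of_forall fun x => hbound x _ _)
  have hVnm : ∀ n, AEStronglyMeasurable (Vn n) μ := fun n =>
    (hVn_smooth n).continuous.aestronglyMeasurable
  have hL1 : Tendsto (fun n => ∫ x, (φ x : ℂ) * fderiv ℝ G (Vn n x) (Wn n x - W x) ∂μ) atTop
      (𝓝 0) := by
    have h0 := hWn_L1.const_mul (Cφ * C')
    rw [mul_zero] at h0
    refine squeeze_zero_norm (fun n => ?_) h0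
    rw [← integral_const_mul]
    exact norm_integral_le_of_norm_le (((hWn_int n).sub hW).norm.const_mul _)
      (Eventually.of_forall fun x => hbound x _ _)
  have hL2 : Tendsto (fun n => ∫ x, (φ x : ℂ) * fderiv ℝ G (Vn n x) (W x) ∂μ) atTop
      (𝓝 (∫ x, (φ x : ℂ) * fderiv ℝ G (V x) (W x) ∂μ)) := by
    refine tendsto_integral_of_dominated_convergence (fun x => Cφ * C' * ‖W x‖)
      (fun n => hmeas (hVnm n) hW.1) (hW.norm.const_mul _)
      (fun n => Eventually.of_forall fun x => hbound x _ _) ?_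
    filter_upwards [hVn_lim] with x hx
    exact tendsto_const_nhds.mul
      (((ContinuousLinearMap.apply ℝ ℂ (W x)).continuous.tendsto _).comp ((hG'.tendsto _).comp hx))
  have hLL := hL1.add hL2
  rw [zero_add] at hLL
  have hlim : ∫ x, (φ x : ℂ) * fderiv ℝ G (V x) (W x) ∂μ =
      -∫ x, (fderiv ℝ φ x e : ℂ) * G (V x) ∂μ := by
    refine tendsto_nhds_unique (hLL.congr' ?_) hR
    filter_upwards [hid] with n hn
    rw [← hn]
    refine (integral_add (hint (hVnm n) ((hWn_int n).sub hW)) (hint (hVnm n) hW)).symm.trans ?_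
    refine integral_congr_ae (Eventually.of_forall fun x => ?_)
    simp only [Pi.sub_apply, map_sub]; ring
  -- Both integrands vanish outside `Ω`, where `V` and `W` differ from `v` and `w`.
  have hφ0 : ∀ x ∉ Ω, φ x = 0 := fun x hx => image_eq_zero_of_notMem_tsupport fun h => hx (hφΩ h)
  have hφd0 : ∀ x ∉ Ω, fderiv ℝ φ x e = 0 := fun x hx => by
    rw [fderiv_of_notMem_tsupport (𝕜 := ℝ) (fun h => hx (hφΩ h))]; rfl
  rw [← setIntegral_eq_integral_of_forall_compl_eq_zero (s := Ω) (fun x hx => by simp [hφ0 x hx]),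
    ← setIntegral_eq_integral_of_forall_compl_eq_zero (s := Ω)
      (f := fun x => (fderiv ℝ φ x e : ℂ) * G (V x)) (fun x hx => by simp [hφd0 x hx])] at hlim
  rw [setIntegral_congr_fun hΩ.measurableSet (g := fun x => (φ x : ℂ) * fderiv ℝ G (V x) (W x))
      (fun x hx => by simp [hVdef, hWdef, hx]),
    setIntegral_congr_fun hΩ.measurableSet (f := fun x => (fderiv ℝ φ x e : ℂ) * G (v x))
      (g := fun x => (fderiv ℝ φ x e : ℂ) * G (V x)) (fun x hx => by simp [hVdef, hx])]
  exact hlim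

end ChainRule

/-! ### A bounded radial truncation -/

section Truncation

/-- The radial weight `h(s) = T(s) / √(1 + s)`, `s = |z|²`, of the map `z ↦ h(|z|²) z` used to test
the equation for the order parameter; `T` is a smooth step from `0` at `s = 1` to `1` at `s = 2`. -/
noncomputable def truncWeight (s : ℝ) : ℝ := Real.smoothTransition (s - 1) / √(1 + s)

/-- The derivative of `truncWeight` on `[0, ∞)`. -/
noncomputable def truncWeightDeriv (s : ℝ) : ℝ :=
  deriv Real.smoothTransition (s - 1) / √(1 + s) - truncWeight s / (2 * (1 + s))

/-- A smooth bounded radial vector field on `ℂ` that vanishes on the closed unit disc and points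
outwards elsewhere. It replaces the truncation `(|z| - 1)₊ z / |z|`, which is neither bounded
nor `C¹`. -/
noncomputable def radialTrunc (z : ℂ) : ℂ := truncWeight (‖z‖ ^ 2) • z

theorem truncWeight_nonneg (s : ℝ) : 0 ≤ truncWeight s :=
  div_nonneg (Real.smoothTransition.nonneg _) (Real.sqrt_nonneg _)

theorem truncWeight_of_le_one {s : ℝ} (hs : s ≤ 1) : truncWeight s = 0 := by
  rw [truncWeight, Real.smoothTransition.zero_of_nonpos (by linarith), zero_div]

theorem truncWeight_pos {s : ℝ} (hs : 1 < s) : 0 < truncWeight s :=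
  div_pos (Real.smoothTransition.pos_of_pos (by linarith)) (Real.sqrt_pos.2 (by linarith))

theorem truncWeight_mul_sqrt_le_one {s : ℝ} (hs : 0 ≤ s) : truncWeight s * √(1 + s) ≤ 1 := by
  have : √(1 + s) ≠ 0 := (Real.sqrt_pos.2 (by linarith)).ne'
  rw [truncWeight, div_mul_cancel₀ _ this]
  exact Real.smoothTransition.le_one _

theorem truncWeight_le_one {s : ℝ} (hs : 0 ≤ s) : truncWeight s ≤ 1 := by
  refine le_trans ?_ (truncWeight_mul_sqrt_le_one hs)
  exact le_mul_of_one_le_right (truncWeight_nonneg s) (Real.one_le_sqrt.2 (by linarith))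

theorem hasDerivAt_truncWeight {s : ℝ} (hs : 0 ≤ s) :
    HasDerivAt truncWeight (truncWeightDeriv s) s := by
  have hpos : 0 < 1 + s := by linarith
  have hsq : 0 < √(1 + s) := Real.sqrt_pos.2 hpos
  have h1 : HasDerivAt (fun s : ℝ => Real.smoothTransition (s - 1))
      (deriv Real.smoothTransition (s - 1)) s := by
    have h : HasDerivAt Real.smoothTransition (deriv Real.smoothTransition (s - 1)) (s - 1) :=
      ((Real.smoothTransition.contDiff (n := 1)).differentiable (by norm_num) _).hasDerivAt
    simpa using h.comp_sub_const s 1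
  have h2 : HasDerivAt (fun s : ℝ => √(1 + s)) (1 / (2 * √(1 + s))) s :=
    ((hasDerivAt_id s).const_add 1).sqrt hpos.ne'
  refine (h1.div h2 hsq.ne').congr_deriv ?_
  have e : √(1 + s) ^ 2 = 1 + s := Real.sq_sqrt hpos.le
  rw [truncWeightDeriv, truncWeight, e]
  field_simp
  rw [e]

theorem deriv_smoothTransition_nonneg (s : ℝ) : 0 ≤ deriv Real.smoothTransition s :=
  Real.smoothTransition.monotone.deriv_nonneg

/-- The profile `r ↦ r h(r²)` of `radialTrunc` is nondecreasing. -/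
theorem truncWeight_add_deriv_nonneg {s : ℝ} (hs : 0 ≤ s) :
    0 ≤ truncWeight s + 2 * truncWeightDeriv s * s := by
  have hpos : 0 < 1 + s := by linarith
  have e : truncWeight s + 2 * truncWeightDeriv s * s =
      truncWeight s / (1 + s) + 2 * s * (deriv Real.smoothTransition (s - 1) / √(1 + s)) := by
    rw [truncWeightDeriv]; field_simp; ring
  rw [e]
  have := truncWeight_nonneg s
  have := deriv_smoothTransition_nonneg (s - 1)
  positivity

theorem exists_abs_truncWeightDeriv_mul_le :
    ∃ C : ℝ, ∀ s : ℝ, 0 ≤ s → |truncWeightDeriv s| * s ≤ C := by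
  have hcont : Continuous (deriv Real.smoothTransition) :=
    (Real.smoothTransition.contDiff (n := 1)).continuous_deriv (by norm_num)
  obtain ⟨C, hC⟩ := (isCompact_Icc (a := (0 : ℝ)) (b := 1)).exists_bound_of_continuousOn
    hcont.continuousOn
  have hzero : ∀ t, t ∉ Icc (0 : ℝ) 1 → deriv Real.smoothTransition t = 0 := by
    intro t ht
    rcases lt_or_ge t 0 with h | h
    · have : Real.smoothTransition =ᶠ[nhds t] fun _ => 0 := by
        filter_upwards [gt_mem_nhds h] with y hy
        exact Real.smoothTransition.zero_of_nonpos (le_of_lt hy)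
      rw [this.deriv_eq]; simp
    · have h1 : 1 < t := by
        by_contra h'
        exact ht ⟨h, not_lt.1 h'⟩
      have : Real.smoothTransition =ᶠ[nhds t] fun _ => 1 := by
        filter_upwards [lt_mem_nhds h1] with y hy
        exact Real.smoothTransition.one_of_one_le (le_of_lt hy)
      rw [this.deriv_eq]; simp
  have hC0 : 0 ≤ C := (norm_nonneg _).trans (hC 0 ⟨le_rfl, zero_le_one⟩)
  refine ⟨C * 2 + 1, fun s hs => ?_⟩
  have hpos : 0 < 1 + s := by linarith
  have hsq : 1 ≤ √(1 + s) := Real.one_le_sqrt.2 (by linarith)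
  have h1 : |deriv Real.smoothTransition (s - 1) / √(1 + s)| * s ≤ C * 2 := by
    by_cases ht : s - 1 ∈ Icc (0 : ℝ) 1
    · have hb : |deriv Real.smoothTransition (s - 1)| ≤ C := hC _ ht
      rw [abs_div, abs_of_pos (by linarith : (0 : ℝ) < √(1 + s))]
      gcongr
      · exact (div_le_self (abs_nonneg _) hsq).trans hb
      · linarith [ht.2]
    · rw [hzero _ ht]; simp; positivity
  have h2 : |truncWeight s / (2 * (1 + s))| * s ≤ 1 := by
    rw [abs_of_nonneg (div_nonneg (truncWeight_nonneg s) (by positivity)), div_mul_eq_mul_div,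
      div_le_one (by positivity)]
    nlinarith [truncWeight_le_one hs, truncWeight_nonneg s]
  calc |truncWeightDeriv s| * s
      ≤ (|deriv Real.smoothTransition (s - 1) / √(1 + s)| +
          |truncWeight s / (2 * (1 + s))|) * s := by
        gcongr
        exact abs_sub _ _
    _ ≤ C * 2 + 1 := by rw [add_mul]; linarith

theorem norm_radialTrunc (z : ℂ) : ‖radialTrunc z‖ = truncWeight (‖z‖ ^ 2) * ‖z‖ := by
  rw [radialTrunc, norm_smul, Real.norm_of_nonneg (truncWeight_nonneg _)]

theorem norm_radialTrunc_le (z : ℂ) : ‖radialTrunc z‖ ≤ 1 := by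
  rw [norm_radialTrunc]
  refine le_trans ?_ (truncWeight_mul_sqrt_le_one (sq_nonneg ‖z‖))
  exact mul_le_mul_of_nonneg_left (Real.le_sqrt_of_sq_le (by linarith)) (truncWeight_nonneg _)

theorem contDiff_radialTrunc : ContDiff ℝ 1 radialTrunc := by
  have h2 : ContDiff ℝ 1 fun z : ℂ => ‖z‖ ^ 2 := contDiff_norm_sq ℝ
  have h1 : ContDiff ℝ 1 fun z : ℂ => truncWeight (‖z‖ ^ 2) := by
    refine ContDiff.div (Real.smoothTransition.contDiff.comp (h2.sub contDiff_const))
      ((contDiff_const.add h2).sqrt fun z => by positivity) fun z => ?_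
    exact (Real.sqrt_pos.2 (by positivity)).ne'
  exact h1.smul contDiff_id

theorem fderiv_radialTrunc (z ζ : ℂ) :
    fderiv ℝ radialTrunc z ζ = truncWeight (‖z‖ ^ 2) • ζ +
      (2 * truncWeightDeriv (‖z‖ ^ 2) * (ζ * conj z).re) • z := by
  have h0 : HasFDerivAt (fun z : ℂ => ‖z‖ ^ 2) (2 • innerSL ℝ z) z :=
    (hasStrictFDerivAt_norm_sq z).hasFDerivAt
  have h1 : HasFDerivAt (fun z : ℂ => truncWeight (‖z‖ ^ 2))
      (truncWeightDeriv (‖z‖ ^ 2) • (2 • innerSL ℝ z)) z :=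
    HasDerivAt.comp_hasFDerivAt (h₂ := truncWeight) z (hasDerivAt_truncWeight (sq_nonneg ‖z‖)) h0
  have h := h1.smul (hasFDerivAt_id z)
  have e : fderiv ℝ radialTrunc z = _ := h.fderiv
  rw [e]
  have hre : (ζ * conj z).re = inner ℝ z ζ := by simp [Complex.inner]
  rw [hre]
  simp only [add_apply, smul_apply, ContinuousLinearMap.smulRight_apply,
    ContinuousLinearMap.id_apply, innerSL_apply_apply, id_eq, nsmul_eq_mul, Nat.cast_ofNat,
    smul_eq_mul]
  congr 2
  ring

theorem exists_norm_fderiv_radialTrunc_le : ∃ C : ℝ, ∀ z, ‖fderiv ℝ radialTrunc z‖ ≤ C := by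
  obtain ⟨C, hC⟩ := exists_abs_truncWeightDeriv_mul_le
  have hC0 : 0 ≤ C := by simpa using hC 0 le_rfl
  refine ⟨1 + 2 * C, fun z => ContinuousLinearMap.opNorm_le_bound _ (by positivity) fun ζ => ?_⟩
  rw [fderiv_radialTrunc]
  have h1 : |(ζ * conj z).re| ≤ ‖ζ‖ * ‖z‖ := by
    simpa using Complex.abs_re_le_norm (ζ * conj z)
  calc ‖truncWeight (‖z‖ ^ 2) • ζ + (2 * truncWeightDeriv (‖z‖ ^ 2) * (ζ * conj z).re) • z‖
      ≤ |truncWeight (‖z‖ ^ 2)| * ‖ζ‖ +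
          2 * |truncWeightDeriv (‖z‖ ^ 2)| * |(ζ * conj z).re| * ‖z‖ := by
        refine (norm_add_le _ _).trans_eq ?_
        simp only [norm_smul, Real.norm_eq_abs, abs_mul, abs_two]
    _ ≤ 1 * ‖ζ‖ + 2 * |truncWeightDeriv (‖z‖ ^ 2)| * (‖ζ‖ * ‖z‖) * ‖z‖ := by
        gcongr
        rw [abs_of_nonneg (truncWeight_nonneg _)]
        exact truncWeight_le_one (sq_nonneg _)
    _ = ‖ζ‖ + 2 * (|truncWeightDeriv (‖z‖ ^ 2)| * ‖z‖ ^ 2) * ‖ζ‖ := by ring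
    _ ≤ ‖ζ‖ + 2 * C * ‖ζ‖ := by gcongr; exact hC _ (sq_nonneg _)
    _ = (1 + 2 * C) * ‖ζ‖ := by ring

/-- The covariant derivatives of `ψ` and of `radialTrunc ψ` have nonnegative product. Here `z`, `ζ`
and `a` stand for a value of `ψ`, of one of its partial derivatives and of a component of the
vector potential. If `p` is the covariant derivative of `ψ`, `m = Re (ζ z*)` and `h` is the weight,
the product is `h |p|² + 2 h' m² / κ²`, while `Im (p z*) = m / κ` gives `m² / κ² ≤ |p|² |z|²`; so
only `h + 2 h' |z|² ≥ 0` is needed when `h'` is negative. -/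
theorem re_covDeriv_mul_conj_radialTrunc_nonneg (κ a : ℝ) (z ζ : ℂ) :
    0 ≤ ((Complex.I / κ * ζ + a * z) *
      conj (Complex.I / κ * fderiv ℝ radialTrunc z ζ + a * radialTrunc z)).re := by
  rw [fderiv_radialTrunc, radialTrunc]
  set h := truncWeight (‖z‖ ^ 2) with hh
  set k := 2 * truncWeightDeriv (‖z‖ ^ 2) with hk
  have hh0 : 0 ≤ h := truncWeight_nonneg _
  have hhk : 0 ≤ h + k * ‖z‖ ^ 2 := truncWeight_add_deriv_nonneg (sq_nonneg ‖z‖)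
  set p := Complex.I / κ * ζ + a * z with hp
  set m := (ζ * conj z).re with hm
  have hI : Complex.I / (κ : ℂ) = Complex.I * ((κ⁻¹ : ℝ) : ℂ) := by push_cast; rfl
  have e : (p * conj (Complex.I / κ * (h • ζ + (k * m) • z) + a * h • z)).re =
      h * ‖p‖ ^ 2 + k * (m * κ⁻¹) ^ 2 := by
    rw [← Complex.normSq_eq_norm_sq, hp, hm, hI]
    simp [Complex.normSq_apply]
    ring
  have him : (p * conj z).im = m * κ⁻¹ := by
    rw [hp, hm, hI]
    simp
    ring
  have hle : (m * κ⁻¹) ^ 2 ≤ ‖p‖ ^ 2 * ‖z‖ ^ 2 := by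
    rw [← him, ← mul_pow, sq_le_sq, abs_of_nonneg (by positivity : 0 ≤ ‖p‖ * ‖z‖)]
    simpa using Complex.abs_im_le_norm (p * conj z)
  rw [e]
  rcases le_or_gt 0 k with hk0 | hk0
  · positivity
  · nlinarith [mul_nonneg hhk (sq_nonneg ‖p‖), mul_le_mul_of_nonpos_left hle hk0.le]

end Truncation

/-! ### Operations on `H¹(Ω)` and `H(curl, Ω)` -/

section SobolevOperations

variable {D : SpaceDim} {Ω : Set (Space D)}

theorem H1.val_integrableOn (hΩb : Bornology.IsBounded Ω) (ψ : H1 Ω) :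
    IntegrableOn ψ.val Ω := by
  have : IsFiniteMeasure (volume.restrict Ω) := ⟨by simpa using hΩb.measure_lt_top⟩
  exact ψ.val_memLp.integrable one_le_two

theorem H1.grad_apply_memLp (ψ : H1 Ω) (j : Fin D.dim) :
    MemLp (fun x => ψ.grad x j) 2 (volume.restrict Ω) :=
  ψ.grad_memLp.eval_piLp j

/-- The composition of `radialTrunc` with an element of `H¹(Ω)`. -/
noncomputable def H1.radialTrunc (hΩ : IsOpen Ω) (hΩb : Bornology.IsBounded Ω) (ψ : H1 Ω) :
    H1 Ω where
  val x := TDGL.radialTrunc (ψ.val x)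
  grad x := WithLp.toLp 2 fun j => fderiv ℝ TDGL.radialTrunc (ψ.val x) (ψ.grad x j)
  val_memLp := by
    refine ψ.val_memLp.of_le
      (contDiff_radialTrunc.continuous.comp_aestronglyMeasurable ψ.val_memLp.1)
      (Filter.Eventually.of_forall fun x => ?_)
    rw [norm_radialTrunc]
    exact mul_le_of_le_one_left (norm_nonneg _) (truncWeight_le_one (sq_nonneg _))
  grad_memLp := by
    obtain ⟨C, hC⟩ := exists_norm_fderiv_radialTrunc_le
    refine MemLp.of_eval_piLp fun j => ?_
    refine (ψ.grad_apply_memLp j).of_le_mul (c := C) (aestronglyMeasurable_clm_apply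
      ((contDiff_radialTrunc.continuous_fderiv (by norm_num)).comp_aestronglyMeasurable
        ψ.val_memLp.1) (ψ.grad_apply_memLp j).1) (Filter.Eventually.of_forall fun x => ?_)
    exact (fderiv ℝ TDGL.radialTrunc (ψ.val x)).le_of_opNorm_le (hC _) _
  isWeakGrad := by
    obtain ⟨C, hC⟩ := exists_norm_fderiv_radialTrunc_le
    have : IsFiniteMeasure (volume.restrict Ω) := ⟨by simpa using hΩb.measure_lt_top⟩
    intro φ hφ i
    exact weakDeriv_comp (e := EuclideanSpace.single i 1) hΩ (ψ.val_integrableOn hΩb)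
      ((ψ.grad_apply_memLp i).integrable one_le_two)
      (fun φ h1 h2 h3 => ψ.isWeakGrad φ ⟨h1, h2, h3⟩ i) contDiff_radialTrunc norm_radialTrunc_le hC
      hφ.1 hφ.2.1 hφ.2.2

theorem IsTestFunction.memLp {φ : Space D → ℝ} (hφ : IsTestFunction Ω φ) :
    MemLp φ 2 (volume.restrict Ω) :=
  (hφ.1.continuous.memLp_of_hasCompactSupport hφ.2.1).restrict Ω

theorem IsTestFunction.partialDeriv_memLp {φ : Space D → ℝ} (hφ : IsTestFunction Ω φ)
    (i : Fin D.dim) : MemLp (partialDeriv i φ) 2 (volume.restrict Ω) :=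
  (((hφ.1.continuous_fderiv (by norm_num)).clm_apply continuous_const).memLp_of_hasCompactSupport
    (hφ.2.1.fderiv_apply ℝ _)).restrict Ω

/-- The difference of two elements of `H¹(Ω)`. -/
def H1.sub (ψ χ : H1 Ω) : H1 Ω where
  val x := ψ.val x - χ.val x
  grad x := ψ.grad x - χ.grad x
  val_memLp := ψ.val_memLp.sub χ.val_memLp
  grad_memLp := ψ.grad_memLp.sub χ.grad_memLp
  isWeakGrad := by
    intro φ hφ i
    have h1 : ∀ u : H1 Ω, Integrable (fun x => (φ x : ℂ) * u.grad x i) (volume.restrict Ω) :=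
      fun u => hφ.memLp.ofReal.integrable_mul (u.grad_apply_memLp i)
    have h2 : ∀ u : H1 Ω, Integrable (fun x => (partialDeriv i φ x : ℂ) * u.val x)
        (volume.restrict Ω) := fun u =>
      (hφ.partialDeriv_memLp i).ofReal.integrable_mul u.val_memLp
    simp only [PiLp.sub_apply, mul_sub]
    rw [integral_sub (h1 ψ) (h1 χ), integral_sub (h2 ψ) (h2 χ), ψ.isWeakGrad φ hφ i,
      χ.isWeakGrad φ hφ i]
    ring

/-- The difference of two elements of `H(curl, Ω)`. -/
def HCurl.sub (A B : HCurl Ω) : HCurl Ω where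
  val x := A.val x - B.val x
  curl x := A.curl x - B.curl x
  val_memLp := A.val_memLp.sub B.val_memLp
  curl_memLp := A.curl_memLp.sub B.curl_memLp
  isWeakCurl := by
    intro φ hφ k
    have h1 : ∀ u : HCurl Ω, Integrable (fun x => φ x * u.curl x k) (volume.restrict Ω) :=
      fun u => hφ.memLp.integrable_mul (u.curl_memLp.eval_piLp k)
    have h2 : ∀ u : HCurl Ω, Integrable (fun x => ∑ i, ∑ j, curlSymbol D k i j *
        (partialDeriv i φ x * u.val x j)) (volume.restrict Ω) := fun u =>
      integrable_finsetSum _ fun i _ => integrable_finsetSum _ fun j _ =>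
        ((hφ.partialDeriv_memLp i).integrable_mul (u.val_memLp.eval_piLp j)).const_mul _
    simp only [PiLp.sub_apply, mul_sub, Finset.sum_sub_distrib]
    rw [integral_sub (h1 A) (h1 B), integral_sub (h2 A) (h2 B), A.isWeakCurl φ hφ k,
      B.isWeakCurl φ hφ k]
    ring

end SobolevOperations

/-! ### The reaction term and its antiderivative -/

section Reaction

/-- A function `g(x, s)` that is measurable in `x` and continuous in `s ∈ [0, 1]` can be composed
with measurable functions: `u` is the limit of its roundings to multiples of `1 / (n + 1)`. -/
theorem aemeasurable_comp_of_continuousOn {α : Type*} [MeasurableSpace α] {ν : Measure α}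
    {g : α → ℝ → ℝ} (hg : ∀ s ∈ Icc (0 : ℝ) 1, AEMeasurable (fun x => g x s) ν)
    (hc : ∀ᵐ x ∂ν, ContinuousOn (g x) (Icc 0 1)) {u : α → ℝ} (hu : AEMeasurable u ν)
    (hu01 : ∀ᵐ x ∂ν, u x ∈ Icc (0 : ℝ) 1) : AEMeasurable (fun x => g x (u x)) ν := by
  let q : ℕ → ℕ → ℝ := fun n k => min ((k : ℝ) / ((n : ℝ) + 1)) 1
  have hq : ∀ n k, q n k ∈ Icc (0 : ℝ) 1 := fun n k =>
    ⟨le_min (by positivity) zero_le_one, min_le_right _ _⟩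
  let r : ℕ → ℝ → ℝ := fun n t => q n ⌊t * ((n : ℝ) + 1)⌋₊
  refine aemeasurable_of_tendsto_metrizable_ae Filter.atTop (f := fun n x => g x (r n (u x)))
    (fun n => ?_) ?_
  · let κ : α → ℕ := fun x => ⌊hu.mk u x * ((n : ℝ) + 1)⌋₊
    have hκ : Measurable κ := Nat.measurable_floor.comp (hu.measurable_mk.mul_const _)
    choose m hm hgm using fun k => hg (q n k) (hq n k)
    have h : Measurable fun p : α × ℕ => m p.2 p.1 := measurable_from_prod_countable_left hm
    refine ⟨fun x => m (κ x) x, h.comp (measurable_id.prodMk hκ), ?_⟩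
    filter_upwards [ae_all_iff.2 hgm, hu.ae_eq_mk] with x hx hux
    rw [← hx (κ x)]
    simp only [r, κ, hux]
  · filter_upwards [hc, hu01] with x hcx hux
    have h1 : Filter.Tendsto (fun n : ℕ => r n (u x)) Filter.atTop (nhds (u x)) := by
      have h2 := (tendsto_nat_floor_mul_div_atTop hux.1).comp
        (Filter.tendsto_atTop_add_const_right _ (1 : ℝ) (tendsto_natCast_atTop_atTop (R := ℝ)))
      have h3 := h2.min (tendsto_const_nhds (x := (1 : ℝ)))
      rw [min_eq_left hux.2] at h3
      exact h3
    exact (hcx (u x) hux).tendsto.comp (tendsto_nhdsWithin_iff.2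
      ⟨h1, Filter.Eventually.of_forall fun n => hq n _⟩)

theorem continuousOn_of_abs_sub_le {f : ℝ → ℝ} {L : ℝ}
    (hf : ∀ s ∈ Icc (0 : ℝ) 1, ∀ t ∈ Icc (0 : ℝ) 1, |f s - f t| ≤ L * |s - t|) :
    ContinuousOn f (Icc 0 1) := by
  refine (LipschitzOnWith.of_dist_le_mul (K := L.toNNReal) fun s hs t ht => ?_).continuousOn
  rw [Real.dist_eq, Real.dist_eq]
  exact (hf s hs t ht).trans (mul_le_mul_of_nonneg_right (Real.le_coe_toNNReal L) (abs_nonneg _))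

/-- Taylor's inequality for an antiderivative of a Lipschitz function. -/
theorem antideriv_sub_le {f F : ℝ → ℝ} {L : ℝ}
    (hf : ∀ s ∈ Icc (0 : ℝ) 1, ∀ t ∈ Icc (0 : ℝ) 1, |f s - f t| ≤ L * |s - t|)
    (hF : ∀ s ∈ Icc (0 : ℝ) 1, HasDerivWithinAt F (f s) (Icc 0 1) s)
    {s t : ℝ} (hs : s ∈ Icc (0 : ℝ) 1) (ht : t ∈ Icc (0 : ℝ) 1) :
    F t - F s ≤ f s * (t - s) + L / 2 * (t - s) ^ 2 := by
  set φ : ℝ → ℝ := fun r => F r - (f s * (r - s) + L / 2 * (r - s) ^ 2) with hφ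
  have hd : ∀ r ∈ Icc (0 : ℝ) 1, HasDerivWithinAt φ (f r - (f s + L * (r - s))) (Icc 0 1) r := by
    intro r hr
    refine (hF r hr).sub (HasDerivAt.hasDerivWithinAt ?_)
    have h1 : HasDerivAt (fun r : ℝ => r - s) 1 r := (hasDerivAt_id r).sub_const s
    refine ((h1.const_mul (f s)).add ((h1.pow 2).const_mul (L / 2))).congr_deriv ?_
    push_cast; ring
  suffices h : φ t ≤ φ s by simp only [hφ] at h; linarith [h]
  rcases le_total s t with hst | hst
  · have hsub : Icc s t ⊆ Icc 0 1 := Icc_subset_Icc hs.1 ht.2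
    refine antitoneOn_of_hasDerivWithinAt_nonpos (convex_Icc s t)
      (fun r hr => ((hd r (hsub hr)).continuousWithinAt.mono hsub))
      (fun r hr => (hd r (hsub (interior_subset hr))).mono (interior_subset.trans hsub))
      (fun r hr => ?_) (left_mem_Icc.2 hst) (right_mem_Icc.2 hst) hst
    have hr' := interior_subset hr
    have := (le_abs_self _).trans (hf r (hsub hr') s hs)
    rw [abs_of_nonneg (sub_nonneg.2 hr'.1)] at this
    linarith
  · have hsub : Icc t s ⊆ Icc 0 1 := Icc_subset_Icc ht.1 hs.2
    refine monotoneOn_of_hasDerivWithinAt_nonneg (convex_Icc t s)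
      (fun r hr => ((hd r (hsub hr)).continuousWithinAt.mono hsub))
      (fun r hr => (hd r (hsub (interior_subset hr))).mono (interior_subset.trans hsub))
      (fun r hr => ?_) (left_mem_Icc.2 hst) (right_mem_Icc.2 hst) hst
    have hr' := interior_subset hr
    have := (neg_le_abs _).trans (hf r (hsub hr') s hs)
    rw [abs_of_nonpos (sub_nonpos.2 hr'.2)] at this
    linarith

theorem neg_mul_le_of_lipschitz {f : ℝ → ℝ} {L : ℝ}
    (hf : ∀ s ∈ Icc (0 : ℝ) 1, ∀ t ∈ Icc (0 : ℝ) 1, |f s - f t| ≤ L * |s - t|)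
    (hf1 : 0 ≤ f 1) {s : ℝ} (hs : s ∈ Icc (0 : ℝ) 1) : -(L * (1 - s)) ≤ f s := by
  have h := (neg_le_abs _).trans (hf s hs 1 (right_mem_Icc.2 zero_le_one))
  rw [abs_of_nonpos (by linarith [hs.2])] at h
  linarith

theorem abs_le_add_of_lipschitz {f : ℝ → ℝ} {L M : ℝ} (hL : 0 ≤ L)
    (hf : ∀ s ∈ Icc (0 : ℝ) 1, ∀ t ∈ Icc (0 : ℝ) 1, |f s - f t| ≤ L * |s - t|)
    (hf1 : 0 ≤ f 1) (hM : f 1 ≤ M) {s : ℝ} (hs : s ∈ Icc (0 : ℝ) 1) : |f s| ≤ M + L := by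
  have h := hf s hs 1 (right_mem_Icc.2 zero_le_one)
  have h1 : |s - 1| ≤ 1 := abs_le.2 ⟨by linarith [hs.1], by linarith [hs.2]⟩
  have h2 : L * |s - 1| ≤ L := mul_le_of_le_one_right hL h1
  have h3 : |f s| ≤ |f s - f 1| + |f 1| := by simpa using abs_add_le (f s - f 1) (f 1)
  rw [abs_of_nonneg hf1] at h3
  linarith

theorem abs_antideriv_sub_le {f F : ℝ → ℝ} {C : ℝ} (hC : ∀ s ∈ Icc (0 : ℝ) 1, |f s| ≤ C)
    (hF : ∀ s ∈ Icc (0 : ℝ) 1, HasDerivWithinAt F (f s) (Icc 0 1) s)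
    {s : ℝ} (hs : s ∈ Icc (0 : ℝ) 1) : |F s - F 1| ≤ C := by
  have h := (convex_Icc (0 : ℝ) 1).norm_image_sub_le_of_norm_hasDerivWithin_le hF hC
    (right_mem_Icc.2 zero_le_one) hs
  have h1 : ‖s - 1‖ ≤ 1 := abs_le.2 ⟨by linarith [hs.1], by linarith [hs.2]⟩
  exact h.trans (mul_le_of_le_one_right ((abs_nonneg _).trans (hC s hs)) h1)

end Reaction

/-! ### Pointwise inequalities -/

section Pointwise

/-- Where `|v| > 1`, the time difference and the stabilization outweigh the negative part of
`c = f(x, |u|²) ≥ -L (1 - |u|²)`. -/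
theorem re_reaction_mul_conj_pos {τ S L c : ℝ} (hτ : 0 < τ) (hL : 0 ≤ L) (hS : 2 * L ≤ S)
    {u v : ℂ} (hu : ‖u‖ ≤ 1) (hv : 1 < ‖v‖) (hc : -(L * (1 - ‖u‖ ^ 2)) ≤ c) :
    0 < (((v - u) / τ + c * v + S * (v - u)) * conj v).re := by
  have e : (((v - u) / τ + c * v + S * (v - u)) * conj v).re =
      (1 / τ + S) * (‖v‖ ^ 2 - (u * conj v).re) + c * ‖v‖ ^ 2 := by
    have hd : (v - u) / (τ : ℂ) = ((1 / τ : ℝ) : ℂ) * (v - u) := by push_cast; ring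
    rw [hd, ← Complex.normSq_eq_norm_sq, Complex.normSq_apply]
    simp
    ring
  have h1 : (u * conj v).re ≤ ‖u‖ * ‖v‖ := by simpa using Complex.re_le_norm (u * conj v)
  rw [e]
  have hu0 := norm_nonneg u
  set ρ := ‖u‖
  set r := ‖v‖
  have hτ' : 0 < 1 / τ := by positivity
  have h2 : r * (r - ρ) ≤ r ^ 2 - (u * conj v).re := by nlinarith
  have h3 : 0 < r * (r - ρ) := by nlinarith
  have h4 : (1 / τ + S) * (r * (r - ρ)) ≤ (1 / τ + S) * (r ^ 2 - (u * conj v).re) :=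
    mul_le_mul_of_nonneg_left h2 (by linarith)
  have h5 : -(L * (1 - ρ ^ 2)) * r ^ 2 ≤ c * r ^ 2 := by gcongr
  have h6 : (2 * L) * (r * (r - ρ)) ≤ S * (r * (r - ρ)) := by gcongr
  have h7 : 0 ≤ 2 * (r * (r - ρ)) - (1 - ρ ^ 2) * r ^ 2 := by
    have : 2 * (r * (r - ρ)) - (1 - ρ ^ 2) * r ^ 2 = r * (2 * ρ * (r - 1) + r * (1 - ρ) ^ 2) := by
      ring
    rw [this]
    have : 0 ≤ r - 1 := by linarith
    positivity
  nlinarith [mul_nonneg hL h7, mul_pos hτ' h3]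

/-- The lower-order terms of the equation for the order parameter, tested with the increment, bound
the increment of the potential energy: the quadratic remainder in Taylor's inequality is absorbed
by the stabilization, as `| |v|² - |u|² | ≤ 2 |v - u|`. -/
theorem potential_le_re_reaction_mul_conj_sub {τ S L : ℝ} (hτ : 0 < τ) (hL : 0 ≤ L)
    (hS : 2 * L ≤ S) {f F : ℝ → ℝ}
    (hf : ∀ s ∈ Icc (0 : ℝ) 1, ∀ t ∈ Icc (0 : ℝ) 1, |f s - f t| ≤ L * |s - t|) (hf1 : 0 ≤ f 1)
    (hF : ∀ s ∈ Icc (0 : ℝ) 1, HasDerivWithinAt F (f s) (Icc 0 1) s)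
    {u v : ℂ} (hu : ‖u‖ ≤ 1) (hv : ‖v‖ ≤ 1) :
    (F (‖v‖ ^ 2) - F (‖u‖ ^ 2)) / 2 ≤
      (((v - u) / τ + f (‖u‖ ^ 2) * v + S * (v - u)) * conj (v - u)).re := by
  have hus : ‖u‖ ^ 2 ∈ Icc (0 : ℝ) 1 := ⟨sq_nonneg _, pow_le_one₀ (norm_nonneg _) hu⟩
  have hvs : ‖v‖ ^ 2 ∈ Icc (0 : ℝ) 1 := ⟨sq_nonneg _, pow_le_one₀ (norm_nonneg _) hv⟩
  have hT := antideriv_sub_le hf hF hus hvs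
  have hc := neg_mul_le_of_lipschitz hf hf1 hus
  set c := f (‖u‖ ^ 2)
  have e : (((v - u) / τ + c * v + S * (v - u)) * conj (v - u)).re =
      (1 / τ + S + c / 2) * ‖v - u‖ ^ 2 + c / 2 * (‖v‖ ^ 2 - ‖u‖ ^ 2) := by
    have hd : (v - u) / (τ : ℂ) = ((1 / τ : ℝ) : ℂ) * (v - u) := by push_cast; ring
    simp only [← Complex.normSq_eq_norm_sq]
    rw [hd]
    simp [Complex.normSq_apply]
    ring
  have hdiff : (‖v‖ ^ 2 - ‖u‖ ^ 2) ^ 2 ≤ 4 * ‖v - u‖ ^ 2 := by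
    have h1 : |‖v‖ - ‖u‖| ≤ ‖v - u‖ := abs_norm_sub_norm_le v u
    have h2 : (‖v‖ - ‖u‖) ^ 2 ≤ ‖v - u‖ ^ 2 := sq_le_sq.2 (by simpa using h1)
    have h3 : (‖v‖ + ‖u‖) ^ 2 ≤ 4 := by nlinarith [norm_nonneg u, norm_nonneg v]
    calc (‖v‖ ^ 2 - ‖u‖ ^ 2) ^ 2 = (‖v‖ + ‖u‖) ^ 2 * (‖v‖ - ‖u‖) ^ 2 := by ring
      _ ≤ 4 * ‖v - u‖ ^ 2 := by gcongr
  have hcL : -L ≤ c := by nlinarith [hus.1]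
  have hτ' : 0 < 1 / τ := by positivity
  rw [e]
  have h1 : L / 2 * (‖v‖ ^ 2 - ‖u‖ ^ 2) ^ 2 ≤ L / 2 * (4 * ‖v - u‖ ^ 2) := by gcongr
  have h2 : L * ‖v - u‖ ^ 2 ≤ (1 / τ + S + c / 2) * ‖v - u‖ ^ 2 :=
    mul_le_mul_of_nonneg_right (by linarith) (sq_nonneg _)
  linarith

theorem half_norm_sq_sub_le_re_mul_conj_sub (p q : ℂ) :
    (‖p‖ ^ 2 - ‖q‖ ^ 2) / 2 ≤ (p * conj (p - q)).re := by
  have h : (p * conj (p - q)).re = (‖p‖ ^ 2 - ‖q‖ ^ 2) / 2 + ‖p - q‖ ^ 2 / 2 := by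
    simp only [← Complex.normSq_eq_norm_sq]
    simp [Complex.normSq_apply]
    ring
  rw [h]
  linarith [sq_nonneg ‖p - q‖]

/-- The current is the derivative of `|(i/κ ∇ + A) ψ|² / 2` with respect to `A`, and this function
of `A` is convex. -/
theorem half_norm_sq_covDeriv_sub_le (κ a b : ℝ) (v ζ : ℂ) :
    (‖Complex.I / κ * ζ + b * v‖ ^ 2 - ‖Complex.I / κ * ζ + a * v‖ ^ 2) / 2 ≤
      ((1 / κ) * (v * conj ζ).im + b * ‖v‖ ^ 2) * (b - a) := by
  have hI : Complex.I / (κ : ℂ) = Complex.I * ((1 / κ : ℝ) : ℂ) := by push_cast; ring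
  have h : ((1 / κ) * (v * conj ζ).im + b * ‖v‖ ^ 2) * (b - a) =
      (‖Complex.I / κ * ζ + b * v‖ ^ 2 - ‖Complex.I / κ * ζ + a * v‖ ^ 2) / 2 +
        (b - a) ^ 2 * ‖v‖ ^ 2 / 2 := by
    simp only [← Complex.normSq_eq_norm_sq]
    rw [hI]
    simp [Complex.normSq_apply]
    ring
  rw [h]
  linarith [mul_nonneg (sq_nonneg (b - a)) (sq_nonneg ‖v‖)]

end Pointwise

/-! ### Square integrability of the terms of the scheme -/

section Integrability

variable {D : SpaceDim} {Ω : Set (Space D)}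

theorem covGrad_apply (κ : ℝ) (A : HCurl Ω) (ψ : H1 Ω) (x : Space D) (j : Fin D.dim) :
    covGrad κ A ψ x j = Complex.I / κ * ψ.grad x j + A.val x j * ψ.val x := rfl

theorem memLp_covGrad (κ : ℝ) (A : HCurl Ω) (ψ : H1 Ω) {M : ℝ}
    (hψ : ∀ᵐ x ∂(volume.restrict Ω), ‖ψ.val x‖ ≤ M) :
    MemLp (covGrad κ A ψ) 2 (volume.restrict Ω) := by
  refine MemLp.of_eval_piLp fun j => ?_
  simp only [covGrad_apply]
  refine ((ψ.grad_apply_memLp j).const_mul _).add ?_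
  have hA : MemLp (fun x => A.val x j) 2 (volume.restrict Ω) := A.val_memLp.eval_piLp j
  refine hA.of_le_mul (c := M) (hA.ofReal.1.mul ψ.val_memLp.1) ?_
  filter_upwards [hψ] with x hx
  rw [norm_mul, Complex.norm_real, mul_comm]
  gcongr

theorem memLp_current (κ : ℝ) (A : HCurl Ω) (ψ : H1 Ω)
    (hψ : ∀ᵐ x ∂(volume.restrict Ω), ‖ψ.val x‖ ≤ 1) :
    MemLp (current κ A ψ) 2 (volume.restrict Ω) := by
  refine MemLp.of_eval_piLp fun j => ?_
  have hA : MemLp (fun x => A.val x j) 2 (volume.restrict Ω) := A.val_memLp.eval_piLp j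
  have hg := ψ.grad_apply_memLp j
  have h1 : MemLp (fun x => (ψ.val x * conj (ψ.grad x j)).im) 2 (volume.restrict Ω) := by
    refine hg.of_le (Complex.continuous_im.comp_aestronglyMeasurable
      (ψ.val_memLp.1.mul (Complex.continuous_conj.comp_aestronglyMeasurable hg.1))) ?_
    filter_upwards [hψ] with x hx
    refine (Complex.abs_im_le_norm _).trans ?_
    rw [norm_mul, RCLike.norm_conj]
    exact mul_le_of_le_one_left (norm_nonneg _) hx
  have h2 : MemLp (fun x => A.val x j * ‖ψ.val x‖ ^ 2) 2 (volume.restrict Ω) := by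
    refine hA.of_le (hA.1.mul (ψ.val_memLp.1.norm.pow 2)) ?_
    filter_upwards [hψ] with x hx
    rw [norm_mul, norm_pow, norm_norm]
    exact mul_le_of_le_one_right (norm_nonneg _) (pow_le_one₀ (norm_nonneg _) hx)
  exact (h1.const_mul (1 / κ)).add h2

theorem memLp_reaction (τ S : ℝ) {c : Space D → ℝ} (hc : AEMeasurable c (volume.restrict Ω))
    {C : ℝ} (hcC : ∀ᵐ x ∂(volume.restrict Ω), |c x| ≤ C) (ψ₀ ψ : H1 Ω) :
    MemLp (fun x => (ψ.val x - ψ₀.val x) / (τ : ℂ) + (c x : ℂ) * ψ.val x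
      + (S : ℂ) * (ψ.val x - ψ₀.val x)) 2 (volume.restrict Ω) := by
  have hd := ψ.val_memLp.sub ψ₀.val_memLp
  have hcψ : MemLp (fun x => (c x : ℂ) * ψ.val x) 2 (volume.restrict Ω) := by
    refine ψ.val_memLp.of_le_mul (c := C)
      ((Complex.continuous_ofReal.comp_aestronglyMeasurable hc.aestronglyMeasurable).mul
        ψ.val_memLp.1) ?_
    filter_upwards [hcC] with x hx
    rw [norm_mul, Complex.norm_real]
    gcongr
    exact hx
  have h1 : MemLp (fun x => (ψ.val x - ψ₀.val x) / (τ : ℂ)) 2 (volume.restrict Ω) := by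
    simp only [div_eq_inv_mul]
    exact hd.const_mul _
  exact (h1.add hcψ).add (hd.const_mul _)

theorem integrable_mul_conj {u v : Space D → ℂ} (hu : MemLp u 2 (volume.restrict Ω))
    (hv : MemLp v 2 (volume.restrict Ω)) :
    Integrable (fun x => u x * conj (v x)) (volume.restrict Ω) :=
  hu.integrable_mul (q := 2) (f := u) hv.star

theorem integrable_sum_mul_conj {u v : Space D → GradSpace D}
    (hu : MemLp u 2 (volume.restrict Ω)) (hv : MemLp v 2 (volume.restrict Ω)) :
    Integrable (fun x => ∑ j, u x j * conj (v x j)) (volume.restrict Ω) :=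
  integrable_finsetSum _ fun j _ => integrable_mul_conj (hu.eval_piLp j) (hv.eval_piLp j)

theorem integrable_inner_of_memLp {V : Type*} [NormedAddCommGroup V] [InnerProductSpace ℝ V]
    {u v : Space D → V} (hu : MemLp u 2 (volume.restrict Ω))
    (hv : MemLp v 2 (volume.restrict Ω)) :
    Integrable (fun x => inner ℝ (u x) (v x)) (volume.restrict Ω) :=
  (hu.norm.integrable_mul hv.norm).mono' (hu.1.inner hv.1)
    (Filter.Eventually.of_forall fun x => norm_inner_le_norm (u x) (v x))

end Integrability

/-! ### The maximum principle and the energy inequality for one step -/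

section EnergyInequality

variable {D : SpaceDim} {Ω : Set (Space D)}

theorem aemeasurable_comp_norm_sq {f : Space D → ℝ → ℝ} (hΩ : IsOpen Ω)
    (hf : ∀ s ∈ Icc (0 : ℝ) 1, AEMeasurable (fun x => f x s) (volume.restrict Ω))
    (hc : ∀ x ∈ Ω, ContinuousOn (f x) (Icc 0 1)) {ψ : H1 Ω}
    (hψ : ∀ᵐ x ∂(volume.restrict Ω), ‖ψ.val x‖ ≤ 1) :
    AEMeasurable (fun x => f x (‖ψ.val x‖ ^ 2)) (volume.restrict Ω) := by
  refine aemeasurable_comp_of_continuousOn hf ?_ (ψ.val_memLp.1.norm.aemeasurable.pow_const 2) ?_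
  · filter_upwards [ae_restrict_mem hΩ.measurableSet] with x hx using hc x hx
  · filter_upwards [hψ] with x hx using ⟨sq_nonneg _, pow_le_one₀ (norm_nonneg _) hx⟩

/-- The potential energy density is integrable, since `F(x, |ψ|²)` differs from `F(x, 1)` by a
bounded function. -/
theorem integrable_potential (hΩ : IsOpen Ω) (hΩb : Bornology.IsBounded Ω)
    {f F : Space D → ℝ → ℝ} {C : ℝ} (hC : ∀ x ∈ Ω, ∀ s ∈ Icc (0 : ℝ) 1, |f x s| ≤ C)
    (hF_deriv : ∀ x ∈ Ω, ∀ s ∈ Icc (0 : ℝ) 1, HasDerivWithinAt (F x) (f x s) (Icc 0 1) s)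
    (hF_int : ∀ s ∈ Icc (0 : ℝ) 1, IntegrableOn (fun x => F x s) Ω) {ψ : H1 Ω}
    (hψ : ∀ᵐ x ∂(volume.restrict Ω), ‖ψ.val x‖ ≤ 1) :
    IntegrableOn (fun x => F x (‖ψ.val x‖ ^ 2)) Ω := by
  have : IsFiniteMeasure (volume.restrict Ω) := ⟨by simpa using hΩb.measure_lt_top⟩
  have h1 := hF_int 1 (right_mem_Icc.2 zero_le_one)
  refine (h1.norm.add (integrable_const C)).mono' (aemeasurable_comp_norm_sq hΩ
    (fun s hs => (hF_int s hs).1.aemeasurable)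
    (fun x hx s hs => (hF_deriv x hx s hs).continuousWithinAt) hψ).aestronglyMeasurable ?_
  filter_upwards [hψ, ae_restrict_mem hΩ.measurableSet] with x hx hxΩ
  have h2 := abs_antideriv_sub_le (hC x hxΩ) (hF_deriv x hxΩ)
    (s := ‖ψ.val x‖ ^ 2) ⟨sq_nonneg _, pow_le_one₀ (norm_nonneg _) hx⟩
  have h3 := abs_add_le (F x (‖ψ.val x‖ ^ 2) - F x 1) (F x 1)
  rw [sub_add_cancel] at h3
  simp only [Pi.add_apply, Real.norm_eq_abs]
  linarith

theorem integrable_energyDensity {κ : ℝ} {F : Space D → ℝ → ℝ} {ψ : H1 Ω}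
    (hF : IntegrableOn (fun x => F x (‖ψ.val x‖ ^ 2)) Ω)
    (hψ : ∀ᵐ x ∂(volume.restrict Ω), ‖ψ.val x‖ ≤ 1) (A : HCurl Ω)
    {h : Space D → CurlSpace D} (hh : MemLp h 2 (volume.restrict Ω)) :
    IntegrableOn (energyDensity κ F ψ A h) Ω :=
  ((memLp_covGrad κ A ψ hψ).integrable_norm_pow two_ne_zero).add hF |>.add
    ((A.curl_memLp.sub hh).integrable_norm_pow two_ne_zero)

/-- The real part of the equation for the order parameter, tested with a bounded function. -/
theorem IsImexStep.re_psi_eq {κ σ τ S L M : ℝ} {f : Space D → ℝ → ℝ} {ψ₀ ψ : H1 Ω}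
    {A₀ A : HCurl Ω} {h : Space D → CurlSpace D} (hstep : IsImexStep κ σ τ S f ψ₀ A₀ ψ A h)
    (hΩ : IsOpen Ω) (hL : 0 ≤ L)
    (hf_meas : ∀ s ∈ Icc (0 : ℝ) 1, AEMeasurable (fun x => f x s) (volume.restrict Ω))
    (hf_lip : ∀ x ∈ Ω, ∀ s ∈ Icc (0 : ℝ) 1, ∀ t ∈ Icc (0 : ℝ) 1, |f x s - f x t| ≤ L * |s - t|)
    (hf_one : ∀ x ∈ Ω, 0 ≤ f x 1) (hM : ∀ x ∈ Ω, f x 1 ≤ M)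
    (hψ₀ : ∀ᵐ x ∂(volume.restrict Ω), ‖ψ₀.val x‖ ≤ 1)
    (χ : H1 Ω) {K : ℝ} (hχ : ∀ᵐ x ∂(volume.restrict Ω), ‖χ.val x‖ ≤ K) {I : Space D → ℝ}
    (hI : I = fun x => (((ψ.val x - ψ₀.val x) / (τ : ℂ) + (f x (‖ψ₀.val x‖ ^ 2) : ℂ) * ψ.val x
        + (S : ℂ) * (ψ.val x - ψ₀.val x)) * conj (χ.val x)).re
      + (∑ j, covGrad κ A₀ ψ x j * conj (covGrad κ A₀ χ x j)).re) :
    Integrable I (volume.restrict Ω) ∧ ∫ x in Ω, I x = 0 := by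
  have hcm := aemeasurable_comp_norm_sq hΩ hf_meas
    (fun x hx => continuousOn_of_abs_sub_le (hf_lip x hx)) hψ₀
  have hcb : ∀ᵐ x ∂(volume.restrict Ω), |f x (‖ψ₀.val x‖ ^ 2)| ≤ M + L := by
    filter_upwards [hψ₀, ae_restrict_mem hΩ.measurableSet] with x hx hxΩ
    exact abs_le_add_of_lipschitz hL (hf_lip x hxΩ) (hf_one x hxΩ) (hM x hxΩ)
      ⟨sq_nonneg _, pow_le_one₀ (norm_nonneg _) hx⟩
  have hint := (integrable_mul_conj (memLp_reaction τ S hcm hcb ψ₀ ψ) χ.val_memLp).add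
    (integrable_sum_mul_conj hstep.covGrad_memLp (memLp_covGrad κ A₀ χ hχ))
  have hre := integral_re hint
  have heq := hstep.psi_eq χ ⟨K, hχ⟩
  simp only [Pi.add_apply, RCLike.re_to_complex, Complex.add_re] at hre
  rw [heq, Complex.zero_re] at hre
  rw [hI]
  exact ⟨hint.re, hre⟩

/-- The maximum principle for one step of the scheme. The equation for the order parameter is tested
with `radialTrunc ψ`; the real part of the resulting integrand is nonnegative, and positive where
`|ψ| > 1`. -/
theorem IsImexStep.norm_val_le_one {κ σ τ S L M : ℝ} {f : Space D → ℝ → ℝ} {ψ₀ ψ : H1 Ω}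
    {A₀ A : HCurl Ω} {h : Space D → CurlSpace D} (hstep : IsImexStep κ σ τ S f ψ₀ A₀ ψ A h)
    (hΩ : IsOpen Ω) (hΩb : Bornology.IsBounded Ω) (hτ : 0 < τ) (hL : 0 ≤ L) (hS : 2 * L ≤ S)
    (hf_meas : ∀ s ∈ Icc (0 : ℝ) 1, AEMeasurable (fun x => f x s) (volume.restrict Ω))
    (hf_lip : ∀ x ∈ Ω, ∀ s ∈ Icc (0 : ℝ) 1, ∀ t ∈ Icc (0 : ℝ) 1, |f x s - f x t| ≤ L * |s - t|)
    (hf_one : ∀ x ∈ Ω, 0 ≤ f x 1) (hM : ∀ x ∈ Ω, f x 1 ≤ M)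
    (hψ₀ : ∀ᵐ x ∂(volume.restrict Ω), ‖ψ₀.val x‖ ≤ 1) :
    ∀ᵐ x ∂(volume.restrict Ω), ‖ψ.val x‖ ≤ 1 := by
  set χ : H1 Ω := ψ.radialTrunc hΩ hΩb
  have hχ1 : ∀ᵐ x ∂(volume.restrict Ω), ‖χ.val x‖ ≤ 1 :=
    Filter.Eventually.of_forall fun x => norm_radialTrunc_le _
  obtain ⟨I, hI⟩ : ∃ I : Space D → ℝ, I = fun x => (((ψ.val x - ψ₀.val x) / (τ : ℂ)
      + (f x (‖ψ₀.val x‖ ^ 2) : ℂ) * ψ.val x + (S : ℂ) * (ψ.val x - ψ₀.val x)) * conj (χ.val x)).re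
      + (∑ j, covGrad κ A₀ ψ x j * conj (covGrad κ A₀ χ x j)).re := ⟨_, rfl⟩
  obtain ⟨hI_int, hre⟩ := hstep.re_psi_eq hΩ hL hf_meas hf_lip hf_one hM hψ₀ χ hχ1 hI
  have hgrad : ∀ x, 0 ≤ (∑ j, covGrad κ A₀ ψ x j * conj (covGrad κ A₀ χ x j)).re := fun x => by
    rw [Complex.re_sum]
    exact Finset.sum_nonneg fun j _ => re_covDeriv_mul_conj_radialTrunc_nonneg κ _ _ _
  -- On `|ψ| ≤ 1` the test function vanishes; elsewhere it is a positive multiple of `ψ`.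
  have hval_zero : ∀ x, ‖ψ.val x‖ ≤ 1 → χ.val x = 0 := fun x hx => by
    change truncWeight (‖ψ.val x‖ ^ 2) • ψ.val x = 0
    rw [truncWeight_of_le_one (pow_le_one₀ (norm_nonneg _) hx), zero_smul]
  have hpos : ∀ᵐ x ∂(volume.restrict Ω), 1 < ‖ψ.val x‖ → 0 < I x := by
    filter_upwards [hψ₀, ae_restrict_mem hΩ.measurableSet] with x hx hxΩ hx1
    have h1 := re_reaction_mul_conj_pos hτ hL hS hx hx1
      (neg_mul_le_of_lipschitz (hf_lip x hxΩ) (hf_one x hxΩ)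
        ⟨sq_nonneg _, pow_le_one₀ (norm_nonneg _) hx⟩)
    have h2 : 0 < truncWeight (‖ψ.val x‖ ^ 2) := truncWeight_pos (one_lt_pow₀ hx1 two_ne_zero)
    have h3 : χ.val x = (truncWeight (‖ψ.val x‖ ^ 2) : ℂ) * ψ.val x := Complex.real_smul
    simp only [hI]
    refine add_pos_of_pos_of_nonneg ?_ (hgrad x)
    rw [h3, map_mul, Complex.conj_ofReal, mul_left_comm, Complex.re_ofReal_mul]
    exact mul_pos h2 h1
  have hnonneg : 0 ≤ᵐ[volume.restrict Ω] I := by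
    filter_upwards [hpos] with x hx
    rcases le_or_gt ‖ψ.val x‖ 1 with h1 | h1
    · simp only [hI, hval_zero x h1, map_zero, mul_zero, Complex.zero_re, zero_add, Pi.zero_apply]
      exact hgrad x
    · exact (hx h1).le
  have hzero := (integral_eq_zero_iff_of_nonneg_ae hnonneg hI_int).1 hre
  filter_upwards [hpos, hzero] with x hx hx0
  by_contra hcon
  exact (hx (not_le.1 hcon)).ne' hx0

/-- The energy inequality for one step whose iterates are bounded by one. The equation for the order
parameter is tested with its increment, that for the vector potential with the increment of the
vector potential. -/
theorem IsImexStep.energy_sub_le {κ σ τ S L M : ℝ} {f F : Space D → ℝ → ℝ} {ψ₀ ψ : H1 Ω}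
    {A₀ A : HCurl Ω} {h₀ h : Space D → CurlSpace D} (hstep : IsImexStep κ σ τ S f ψ₀ A₀ ψ A h)
    (hΩ : IsOpen Ω) (hσ : 0 < σ) (hτ : 0 < τ) (hL : 0 ≤ L) (hS : 2 * L ≤ S)
    (hf_meas : ∀ s ∈ Icc (0 : ℝ) 1, AEMeasurable (fun x => f x s) (volume.restrict Ω))
    (hf_lip : ∀ x ∈ Ω, ∀ s ∈ Icc (0 : ℝ) 1, ∀ t ∈ Icc (0 : ℝ) 1, |f x s - f x t| ≤ L * |s - t|)
    (hf_one : ∀ x ∈ Ω, 0 ≤ f x 1) (hM : ∀ x ∈ Ω, f x 1 ≤ M)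
    (hF_deriv : ∀ x ∈ Ω, ∀ s ∈ Icc (0 : ℝ) 1, HasDerivWithinAt (F x) (f x s) (Icc 0 1) s)
    (hψ₀ : ∀ᵐ x ∂(volume.restrict Ω), ‖ψ₀.val x‖ ≤ 1)
    (hψ : ∀ᵐ x ∂(volume.restrict Ω), ‖ψ.val x‖ ≤ 1)
    (hh₀ : MemLp h₀ 2 (volume.restrict Ω)) (hh : MemLp h 2 (volume.restrict Ω))
    (hE₀ : IntegrableOn (energyDensity κ F ψ₀ A₀ h₀) Ω)
    (hE : IntegrableOn (energyDensity κ F ψ A h) Ω) :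
    energy κ F ψ A h - energy κ F ψ₀ A₀ h₀ ≤
      ∫ x in Ω, inner ℝ (h x - A.curl x) (h x - h₀ x) := by
  set χ : H1 Ω := ψ.sub ψ₀ with hχ
  have hχ2 : ∀ᵐ x ∂(volume.restrict Ω), ‖χ.val x‖ ≤ 2 := by
    filter_upwards [hψ₀, hψ] with x hx hx'
    exact (norm_sub_le _ _).trans (by linarith)
  obtain ⟨I, hI⟩ : ∃ I : Space D → ℝ, I = fun x => (((ψ.val x - ψ₀.val x) / (τ : ℂ)
      + (f x (‖ψ₀.val x‖ ^ 2) : ℂ) * ψ.val x + (S : ℂ) * (ψ.val x - ψ₀.val x)) * conj (χ.val x)).re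
      + (∑ j, covGrad κ A₀ ψ x j * conj (covGrad κ A₀ χ x j)).re := ⟨_, rfl⟩
  obtain ⟨hI_int, hre⟩ := hstep.re_psi_eq hΩ hL hf_meas hf_lip hf_one hM hψ₀ χ hχ2 hI
  have hAeq := hstep.A_eq (A.sub A₀)
  set J : Space D → ℝ := fun x => (σ / τ) * inner ℝ (A.val x - A₀.val x) ((A.sub A₀).val x)
    + inner ℝ (A.curl x - h x) ((A.sub A₀).curl x)
    + inner ℝ (current κ A ψ x) ((A.sub A₀).val x) with hJ
  have hJ_int : Integrable J (volume.restrict Ω) :=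
    ((integrable_inner_of_memLp (A.val_memLp.sub A₀.val_memLp)
      (A.sub A₀).val_memLp).const_mul _).add
      (integrable_inner_of_memLp (A.curl_memLp.sub hh) (A.sub A₀).curl_memLp) |>.add
      (integrable_inner_of_memLp (memLp_current κ A ψ hψ) (A.sub A₀).val_memLp)
  have hR_int : Integrable (fun x => inner ℝ (h x - A.curl x) (h x - h₀ x))
      (volume.restrict Ω) := integrable_inner_of_memLp (hh.sub A.curl_memLp) (hh.sub hh₀)
  -- Polarization, with `curl (A - A₀) = (p - q) + (h - h₀)` for `p = curl A - h` and
  -- `q = curl A₀ - h₀`.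
  have hcurl : ∀ x, (‖A.curl x - h x‖ ^ 2 - ‖A₀.curl x - h₀ x‖ ^ 2) / 2 ≤
      inner ℝ (A.curl x - h x) (A.curl x - A₀.curl x) +
        inner ℝ (h x - A.curl x) (h x - h₀ x) := by
    intro x
    set p := A.curl x - h x with hp
    set q := A₀.curl x - h₀ x with hq
    have e1 : A.curl x - A₀.curl x = (p - q) + (h x - h₀ x) := by rw [hp, hq]; abel
    have e2 : h x - A.curl x = -p := by rw [hp]; abel
    have h1 := norm_sub_sq_real p q
    rw [e1, e2, inner_add_right, inner_neg_left, inner_sub_right, real_inner_self_eq_norm_sq]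
    nlinarith [sq_nonneg ‖p - q‖]
  have hmain : ∀ᵐ x ∂(volume.restrict Ω),
      (1 / 2) * (energyDensity κ F ψ A h x - energyDensity κ F ψ₀ A₀ h₀ x) ≤
        I x + J x + inner ℝ (h x - A.curl x) (h x - h₀ x) := by
    filter_upwards [hψ₀, hψ, ae_restrict_mem hΩ.measurableSet] with x hx₀ hx hxΩ
    have h1 := potential_le_re_reaction_mul_conj_sub hτ hL hS (hf_lip x hxΩ) (hf_one x hxΩ)
      (hF_deriv x hxΩ) hx₀ hx
    have h2 : (‖covGrad κ A₀ ψ x‖ ^ 2 - ‖covGrad κ A₀ ψ₀ x‖ ^ 2) / 2 ≤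
        (∑ j, covGrad κ A₀ ψ x j * conj (covGrad κ A₀ χ x j)).re := by
      rw [EuclideanSpace.norm_sq_eq, EuclideanSpace.norm_sq_eq, ← Finset.sum_sub_distrib,
        Finset.sum_div, Complex.re_sum]
      refine Finset.sum_le_sum fun j _ => ?_
      have e : covGrad κ A₀ χ x j = covGrad κ A₀ ψ x j - covGrad κ A₀ ψ₀ x j := by
        simp only [covGrad_apply, hχ, H1.sub, PiLp.sub_apply]
        ring
      rw [e]
      exact half_norm_sq_sub_le_re_mul_conj_sub _ _
    have h3 : (‖covGrad κ A ψ x‖ ^ 2 - ‖covGrad κ A₀ ψ x‖ ^ 2) / 2 ≤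
        inner ℝ (current κ A ψ x) (A.val x - A₀.val x) := by
      rw [EuclideanSpace.norm_sq_eq, EuclideanSpace.norm_sq_eq, ← Finset.sum_sub_distrib,
        Finset.sum_div, PiLp.inner_apply]
      refine Finset.sum_le_sum fun j _ => ?_
      rw [real_inner_comm]
      exact (half_norm_sq_covDeriv_sub_le κ _ _ _ _).trans_eq (by simp [current, mul_comm])
    have h4 : 0 ≤ (σ / τ) * inner ℝ (A.val x - A₀.val x) (A.val x - A₀.val x) :=
      mul_nonneg (by positivity) real_inner_self_nonneg
    have h5 := hcurl x
    have e1 : I x = (((ψ.val x - ψ₀.val x) / (τ : ℂ) + (f x (‖ψ₀.val x‖ ^ 2) : ℂ) * ψ.val x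
        + (S : ℂ) * (ψ.val x - ψ₀.val x)) * conj (ψ.val x - ψ₀.val x)).re
        + (∑ j, covGrad κ A₀ ψ x j * conj (covGrad κ A₀ χ x j)).re := by rw [hI]; rfl
    have e2 : J x = (σ / τ) * inner ℝ (A.val x - A₀.val x) (A.val x - A₀.val x)
        + inner ℝ (A.curl x - h x) (A.curl x - A₀.curl x)
        + inner ℝ (current κ A ψ x) (A.val x - A₀.val x) := rfl
    rw [e1, e2, energyDensity, energyDensity]
    linarith
  have hint := integral_mono_ae ((hE.sub hE₀).const_mul (1 / 2)) ((hI_int.add hJ_int).add hR_int)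
    hmain
  have hsum : ∫ x in Ω, (I x + J x + inner ℝ (h x - A.curl x) (h x - h₀ x)) =
      ∫ x in Ω, inner ℝ (h x - A.curl x) (h x - h₀ x) := by
    have hs : ∫ x in Ω, (I x + J x) = 0 := by
      rw [integral_add hI_int hJ_int, hre, hAeq, add_zero]
    exact (integral_add (hI_int.add hJ_int) hR_int).trans
      (by simp only [Pi.add_apply, hs, zero_add])
  calc energy κ F ψ A h - energy κ F ψ₀ A₀ h₀
      = ∫ x in Ω, (1 / 2) * (energyDensity κ F ψ A h x - energyDensity κ F ψ₀ A₀ h₀ x) := by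
        rw [integral_const_mul, integral_sub hE hE₀, energy, energy]
        ring
    _ ≤ ∫ x in Ω, (I x + J x + inner ℝ (h x - A.curl x) (h x - h₀ x)) := hint
    _ = _ := hsum

end EnergyInequality

end TDGL

theorem mainTheorem2 (D : TDGL.SpaceDim) (Ω : Set (TDGL.Space D)) (hΩ : IsOpen Ω)
    (hΩb : Bornology.IsBounded Ω)
    (κ σ τ S L : ℝ) (hκ : 0 < κ) (hσ : 0 < σ) (hτ : 0 < τ) (hL : 0 ≤ L) (hS : 2 * L ≤ S)
    (f F : TDGL.Space D → ℝ → ℝ)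
    (hf_meas : ∀ s ∈ Icc (0 : ℝ) 1, AEMeasurable (fun x => f x s) (volume.restrict Ω))
    (hf_lip : ∀ x ∈ Ω, ∀ s ∈ Icc (0 : ℝ) 1, ∀ t ∈ Icc (0 : ℝ) 1, |f x s - f x t| ≤ L * |s - t|)
    (hf_one : ∀ x ∈ Ω, 0 ≤ f x 1) (hf_bdd : ∃ M : ℝ, ∀ x ∈ Ω, f x 1 ≤ M)
    (hF_deriv : ∀ x ∈ Ω, ∀ s ∈ Icc (0 : ℝ) 1, HasDerivWithinAt (F x) (f x s) (Icc 0 1) s)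
    (hF_int : ∀ s ∈ Icc (0 : ℝ) 1, IntegrableOn (fun x => F x s) Ω)
    (N : ℕ) (ψ : ℕ → TDGL.H1 Ω) (A : ℕ → TDGL.HCurl Ω) (H : ℕ → TDGL.Space D → TDGL.CurlSpace D)
    (hH : ∀ n ≤ N, MemLp (H n) 2 (volume.restrict Ω))
    (hψ₀ : ∀ᵐ x ∂(volume.restrict Ω), ‖(ψ 0).val x‖ ≤ 1)
    (hstep : ∀ n < N,
      TDGL.IsImexStep κ σ τ S f (ψ n) (A n) (ψ (n + 1)) (A (n + 1)) (H (n + 1))) :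
    (∀ n ≤ N, IntegrableOn (TDGL.energyDensity κ F (ψ n) (A n) (H n)) Ω) ∧
    (∀ n < N,
      TDGL.energy κ F (ψ (n + 1)) (A (n + 1)) (H (n + 1)) - TDGL.energy κ F (ψ n) (A n) (H n) ≤
        ∫ x in Ω, inner ℝ (H (n + 1) x - (A (n + 1)).curl x) (H (n + 1) x - H n x)) ∧
    (∀ n < N, H (n + 1) =ᵐ[volume.restrict Ω] H n →
      TDGL.energy κ F (ψ (n + 1)) (A (n + 1)) (H (n + 1)) ≤
        TDGL.energy κ F (ψ n) (A n) (H n)) := by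
  obtain ⟨M, hM⟩ := hf_bdd
  have hψ : ∀ n ≤ N, ∀ᵐ x ∂(volume.restrict Ω), ‖(ψ n).val x‖ ≤ 1 := by
    intro n
    induction n with
    | zero => exact fun _ => hψ₀
    | succ n ih =>
      exact fun hn => (hstep n hn).norm_val_le_one hΩ hΩb hτ hL hS hf_meas hf_lip hf_one hM
        (ih (Nat.le_of_succ_le hn))
  have hE : ∀ n ≤ N, IntegrableOn (TDGL.energyDensity κ F (ψ n) (A n) (H n)) Ω := fun n hn =>
    TDGL.integrable_energyDensity
      (TDGL.integrable_potential hΩ hΩb (C := M + L)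
        (fun x hx s hs => TDGL.abs_le_add_of_lipschitz hL (hf_lip x hx) (hf_one x hx) (hM x hx) hs)
        hF_deriv hF_int (hψ n hn))
      (hψ n hn) (A n) (hH n hn)
  have hdiff : ∀ n < N,
      TDGL.energy κ F (ψ (n + 1)) (A (n + 1)) (H (n + 1)) - TDGL.energy κ F (ψ n) (A n) (H n) ≤
        ∫ x in Ω, inner ℝ (H (n + 1) x - (A (n + 1)).curl x) (H (n + 1) x - H n x) := fun n hn =>
    (hstep n hn).energy_sub_le hΩ hσ hτ hL hS hf_meas hf_lip hf_one hM hF_deriv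
      (hψ n hn.le) (hψ (n + 1) hn) (hH n hn.le) (hH (n + 1) hn) (hE n hn.le) (hE (n + 1) hn)
  refine ⟨hE, hdiff, fun n hn hHn => ?_⟩
  have h0 : ∫ x in Ω, inner ℝ (H (n + 1) x - (A (n + 1)).curl x) (H (n + 1) x - H n x) = 0 := by
    refine integral_eq_zero_of_ae ?_
    filter_upwards [hHn] with x hx
    simp [hx]
  linarith [hdiff n hn]
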